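/- Conventions. A shift space over a finite alphabet $\mathcal A$ (with the discrete topology) is a closed subset $X\subseteq\mathcal A^{\mathbb Z}$ (product topology) that is invariant under all powers of the shift map $\sigma(x)_i=x_{i+1}$. Let $B_n(X)$ be the set of words of length $n$ occurring in points of $X$; the entropy of $X$ is $h(X)=\lim_{n\to\infty}\frac1n\log_2|B_n(X)|$ (with $\log_2 0$ read as $0$ if $X=\emptyset$). $X$ is of finite type if it is the set of all points of $\mathcal A^{\mathbb Z}$ in which no word of some finite set of words occurs. $X$ is sofic if there is a finite directed graph with edges labelled in $\mathcal A$ such that $X$ is the set of label sequences of bi-infinite walks on the graph. The suspension of $X$ is the quotient space $SX=(X\times\mathbb R)/\!\sim$, where $\sim$ is the equivalence relation generated by $(x,t+1)\sim(\sigma(x),t)$; write $[x,t]$ for the class of $(x,t)$. Shift spaces $X$ and $Y$ (possibly over different finite alphabets) are flow equivalent if there is a homeomorphism $\Phi\colon SX\to SY$ such that for every $[x,t]\in SX$ there is a strictly increasing function $\phi\colon\mathbb R\to\mathbb R$ such that $\Phi([x,t])=[y,t']$ implies $\Phi([x,t+r])=[y,t'+\phi(r)]$ for all $r\in\mathbb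 R$. Let $h([X])$ be the set of all $h(Y)$, where $Y$ ranges over the shift spaces over finite alphabets that are flow equivalent to $X$. Theorem. Let $X$ be a sofic shift with $h(X)>0$. Then $h([X])$ is dense in $\mathbb R^+=(0,\infty)$, that is, every $r>0$ lies in the closure of $h([X])$. The same holds for every shift of finite type $X$ with $h(X)>0$. -/

import Mathlib

open Set Filter Topology
open SymbolicDynamics.FullShift (Subshift shift)

universe u

namespace FlowShift

/-! Shift spaces over a finite discrete alphabet `A` are Mathlib's `Subshift A ℤ`: closed subsets
of `ℤ → A` invariant under all translations `shift g`, where `(shift 1 x) i = x (1 + i)`. -/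

section Words

variable {A : Type u}

/-- The word `w` occurs in the bi-infinite sequence `x`: `x_i x_{i+1} … x_{i+|w|-1} = w` for
some `i`. -/
def Occurs (w : List A) (x : ℤ → A) : Prop :=
  ∃ i : ℤ, w = List.ofFn (fun k : Fin w.length => x (i + (k : ℕ)))

/-- The points of the full shift in which no word of `F` occurs. -/
def avoiding (F : Set (List A)) : Set (ℤ → A) :=
  {x | ∀ w ∈ F, ¬ Occurs w x}

variable [TopologicalSpace A]

/-- `B_n(X)`: the words of length `n` that occur in some point of `X`. -/
def blocks (X : Subshift A ℤ) (n : ℕ) : Set (List A) :=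
  {w | w.length = n ∧ ∃ x ∈ X.carrier, Occurs w x}

/-- The entropy `h(X) = lim (1/n) log₂ |B_n(X)|`. The limit exists, see `tendsto_entropy`. -/
noncomputable def entropy (X : Subshift A ℤ) : ℝ :=
  limUnder atTop (fun n : ℕ => Real.logb 2 ((blocks X n).ncard : ℝ) / n)

/-- A shift of finite type: given by a finite set of forbidden words. -/
def IsFiniteType (X : Subshift A ℤ) : Prop :=
  ∃ F : Set (List A), F.Finite ∧ X.carrier = avoiding F

end Words

/-- A finite directed graph (multiple edges and loops allowed) with edges labelled in `A`. -/
structure LabeledGraph (A : Type u) where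
  /-- vertices -/
  V : Type u
  /-- edges -/
  E : Type u
  finite_V : Finite V
  finite_E : Finite E
  /-- the vertex at which an edge starts -/
  source : E → V
  /-- the vertex at which an edge terminates -/
  target : E → V
  /-- the labelling of the edges -/
  label : E → A

namespace LabeledGraph

variable {A : Type u}

/-- The edge shift of the underlying graph: all bi-infinite walks. -/
def edgeShift (G : LabeledGraph A) : Set (ℤ → G.E) :=
  {e | ∀ i : ℤ, G.target (e i) = G.source (e (i + 1))}

/-- The set of label sequences of bi-infinite walks. -/
def presented (G : LabeledGraph A) : Set (ℤ → A) :=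
  (fun e i => G.label (e i)) '' G.edgeShift

end LabeledGraph

section Flow

variable {A : Type u} [TopologicalSpace A]

/-- A sofic shift: presented by a finite labelled graph. -/
def IsSofic (X : Subshift A ℤ) : Prop :=
  ∃ G : LabeledGraph A, X.carrier = G.presented

/-- The shift map `σ_X : X → X`, `σ_X(x)_i = x_{i+1}`. -/
def shiftMap (X : Subshift A ℤ) (x : X.carrier) : X.carrier :=
  ⟨shift 1 x.1, X.mapsTo 1 x.2⟩

/-- The relation `(x, t + 1) ∼ (σ_X(x), t)` on `X × ℝ`. -/
inductive SuspRel (X : Subshift A ℤ) : X.carrier × ℝ → X.carrier × ℝ → Prop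
  | step (x : X.carrier) (t : ℝ) : SuspRel X (x, t + 1) (shiftMap X x, t)

/-- The suspension `SX`: the quotient of `X × ℝ` by the equivalence relation generated by
`(x, t + 1) ∼ (σ_X(x), t)`. -/
def Suspension (X : Subshift A ℤ) : Type u :=
  Quot (SuspRel X)

/-- The quotient topology of the product topology. -/
instance (X : Subshift A ℤ) : TopologicalSpace (Suspension X) :=
  inferInstanceAs (TopologicalSpace (Quot (SuspRel X)))

/-- The class `[x, t]` in the suspension. -/
def Suspension.mk {X : Subshift A ℤ} (x : X.carrier) (t : ℝ) : Suspension X :=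
  Quot.mk (SuspRel X) (x, t)

/-- Flow equivalence: a homeomorphism of the suspensions which carries flow lines to flow lines
and preserves the direction of time. -/
def FlowEquivalent {B : Type u} [TopologicalSpace B] (X : Subshift A ℤ) (Y : Subshift B ℤ) :
    Prop :=
  ∃ Φ : Suspension X ≃ₜ Suspension Y, ∀ (x : X.carrier) (t : ℝ),
    ∃ φ : ℝ → ℝ, StrictMono φ ∧
      ∀ (y : Y.carrier) (t' : ℝ), Φ (Suspension.mk x t) = Suspension.mk y t' →
        ∀ r : ℝ, Φ (Suspension.mk x (t + r)) = Suspension.mk y (t' + φ r)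

/-- `h([X])`: the entropies of all shift spaces, over arbitrary finite discrete alphabets, that are
flow equivalent to `X`. -/
def flowEntropies (X : Subshift A ℤ) : Set ℝ :=
  {s | ∃ (B : Type u) (_ : Finite B) (_ : TopologicalSpace B) (_ : DiscreteTopology B)
    (Y : Subshift B ℤ), FlowEquivalent X Y ∧ entropy Y = s}

end Flow

section EntropyLimit

variable {A : Type u} [TopologicalSpace A]

theorem blocks_finite [Finite A] (X : Subshift A ℤ) (n : ℕ) : (blocks X n).Finite :=
  (List.finite_length_eq A n).subset fun _ hw => hw.1

theorem ofFn_mem_blocks (X : Subshift A ℤ) {x : ℤ → A} (hx : x ∈ X.carrier) (i : ℤ) (n : ℕ) :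
    List.ofFn (fun k : Fin n => x (i + (k : ℕ))) ∈ blocks X n := by
  refine ⟨List.length_ofFn, x, hx, i, ?_⟩
  apply List.ext_getElem <;> simp

theorem mem_blocks_iff (X : Subshift A ℤ) (n : ℕ) (w : List A) :
    w ∈ blocks X n ↔
      ∃ x ∈ X.carrier, ∃ i : ℤ, w = List.ofFn (fun k : Fin n => x (i + (k : ℕ))) := by
  constructor
  · rintro ⟨rfl, x, hx, i, hi⟩
    exact ⟨x, hx, i, hi⟩
  · rintro ⟨x, hx, i, rfl⟩
    exact ofFn_mem_blocks X hx i n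

theorem ncard_blocks_add_le [Finite A] (X : Subshift A ℤ) (m n : ℕ) :
    (blocks X (m + n)).ncard ≤ (blocks X m).ncard * (blocks X n).ncard := by
  rw [← Set.ncard_prod]
  refine Set.ncard_le_ncard_of_injOn (fun w => (w.take m, w.drop m)) ?_ ?_
    ((blocks_finite X m).prod (blocks_finite X n))
  · intro w hw
    obtain ⟨x, hx, i, rfl⟩ := (mem_blocks_iff X (m + n) w).1 hw
    refine ⟨(mem_blocks_iff X m _).2 ⟨x, hx, i, ?_⟩,
      (mem_blocks_iff X n _).2 ⟨x, hx, i + m, ?_⟩⟩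
    · apply List.ext_getElem <;> simp
    · apply List.ext_getElem <;> simp [add_assoc]
  · intro w _ w' _ h
    simp only [Prod.mk.injEq] at h
    rw [← List.take_append_drop m w, ← List.take_append_drop m w', h.1, h.2]

/-- The limit in the definition of the entropy exists. -/
theorem tendsto_entropy [Finite A] (X : Subshift A ℤ) :
    Tendsto (fun n : ℕ => Real.logb 2 ((blocks X n).ncard : ℝ) / n) atTop (𝓝 (entropy X)) := by
  have hsub : Subadditive (fun n : ℕ => Real.logb 2 ((blocks X n).ncard : ℝ)) := by
    intro m n
    rcases X.carrier.eq_empty_or_nonempty with h | ⟨x, hx⟩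
    · have h0 : ∀ k, blocks X k = ∅ := fun k => by
        ext w
        simp [mem_blocks_iff, h]
      simp [h0]
    · have hpos : ∀ k, (0 : ℝ) < ((blocks X k).ncard : ℝ) := fun k => by
        exact_mod_cast (Set.ncard_pos (blocks_finite X k)).2 ⟨_, ofFn_mem_blocks X hx 0 k⟩
      rw [← Real.logb_mul (hpos m).ne' (hpos n).ne']
      exact Real.logb_le_logb_of_le (by norm_num) (hpos _)
        (by exact_mod_cast ncard_blocks_add_le X m n)
  have hbdd : BddBelow (range fun n : ℕ => Real.logb 2 ((blocks X n).ncard : ℝ) / n) := by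
    refine ⟨0, ?_⟩
    rintro _ ⟨n, rfl⟩
    refine div_nonneg ?_ (Nat.cast_nonneg n)
    rcases Nat.eq_zero_or_pos (blocks X n).ncard with h | h
    · simp [h]
    · exact Real.logb_nonneg (by norm_num) (by exact_mod_cast h)
  exact tendsto_nhds_limUnder ⟨_, hsub.tendsto_lim hbdd⟩

end EntropyLimit

end FlowShift

/-! Flow equivalence forgets the return times to a cross-section. If a clopen set C is met by every
orbit within bounded time, then X is a tower over the first return map T of C, and any subshift that
is a tower over (C, T) with another height function is flow equivalent to X
(`IsTower.flowEquivalent`). Constant height k is realised by `towerShift`, whose entropy is L / k,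
where L is the entropy of (C, T) (`entropy_towerShift`). So all fractions L / k lie in h([X]), and
they become dense in (0, ∞) as L grows. What remains is to find sections with L arbitrarily large:
few visits, much information between them.

A sofic shift of positive entropy has two different words u, v of equal length labelling cycles at
one vertex, since otherwise the number of words grows polynomially; hence X contains every
concatenation of u and v. The section consists of the occurrences of uuuu, together with the points
that see no such occurrence for N steps (`markedOrLone`). In the concatenations considered, each
period is a marker of six blocks u followed by K pairs, each freely chosen as uv or vu. An
occurrence of uuuu covers a pair of equal blocks, so it lies near a marker. Thus a period has O(|u|)
visits but K free bits, which gives L ≥ K / (12 |u|) (`exists_large_flowEntropies`). -/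

namespace FlowShift

/-! ### The suspension as a Hausdorff quotient by a ℤ-action. -/

section Suspension

variable {A : Type u} [TopologicalSpace A]

/-- The action of the translation by `n` on the points of a subshift. -/
def sh {X : Subshift A ℤ} (n : ℤ) (x : X.carrier) : X.carrier :=
  ⟨shift n x.1, X.mapsTo n x.2⟩

variable {X : Subshift A ℤ}

theorem sh_apply (n : ℤ) (x : X.carrier) (i : ℤ) : (sh n x).1 i = x.1 (n + i) := rfl

@[simp] theorem sh_zero (x : X.carrier) : sh 0 x = x := by
  ext i; simp [sh_apply]

theorem sh_sh (m n : ℤ) (x : X.carrier) : sh m (sh n x) = sh (m + n) x := by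
  ext i; exact congrArg x.1 (by ring)

theorem sh_injective (n : ℤ) : Function.Injective (sh (X := X) n) := fun x y h => by
  simpa [sh_sh] using congrArg (sh (-n)) h

theorem continuous_sh (n : ℤ) : Continuous (sh (X := X) n) :=
  by
  refine Continuous.subtype_mk ?_ _
  exact continuous_pi fun h => (continuous_apply (n + h)).comp continuous_subtype_val

theorem continuous_suspension_mk :
    Continuous fun p : X.carrier × ℝ => Suspension.mk p.1 p.2 :=
  continuous_quot_mk

theorem Suspension.exists_mk (p : Suspension X) : ∃ x t, Suspension.mk x t = p := by
  induction p using Quot.ind with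
  | mk p => exact ⟨p.1, p.2, rfl⟩

theorem Suspension.mk_add_one (x : X.carrier) (t : ℝ) :
    Suspension.mk x (t + 1) = Suspension.mk (sh 1 x) t :=
  Quot.sound (SuspRel.step x t)

theorem Suspension.mk_add_intCast (x : X.carrier) (t : ℝ) (n : ℤ) :
    Suspension.mk x (t + n) = Suspension.mk (sh n x) t := by
  induction n using Int.induction_on generalizing x t with
  | zero => simp
  | succ i ih =>
    have := Suspension.mk_add_one x (t + i)
    push_cast at ih ⊢
    rw [← add_assoc, this, ih, sh_sh]
  | pred i ih =>
    have := Suspension.mk_add_one (sh (-1) x) (t - i - 1)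
    rw [sub_add_cancel, sh_sh] at this
    push_cast at ih ⊢
    have h2 := ih (sh (-1) x) t
    rw [sh_sh] at h2
    rw [show (-(i : ℤ) - 1) = -i + -1 by ring, ← h2]
    simp only [add_neg_cancel, sh_zero] at this
    rw [show t + -(i : ℝ) = t - i by ring, this]
    congr 1; ring

/-- The generated equivalence is the orbit relation of the ℤ-action (x, t) ↦ (σⁿ x, t − n). -/
theorem Suspension.mk_eq_mk_iff (x y : X.carrier) (t s : ℝ) :
    Suspension.mk x t = Suspension.mk y s ↔ ∃ n : ℤ, t = s + n ∧ y = sh n x := by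
  constructor
  · intro h
    have h' : Relation.EqvGen (SuspRel X) (x, t) (y, s) := Quot.eqvGen_exact h
    suffices H : ∀ p q, Relation.EqvGen (SuspRel X) p q →
        ∃ n : ℤ, p.2 = q.2 + n ∧ q.1 = sh n p.1 from H _ _ h'
    intro p q hpq
    induction hpq with
    | rel p q h =>
      obtain ⟨x, t⟩ := h
      exact ⟨1, by simp, rfl⟩
    | refl p => exact ⟨0, by simp⟩
    | symm p q _ ih =>
      obtain ⟨n, h1, h2⟩ := ih
      exact ⟨-n, by rw [h1]; simp, by rw [h2, sh_sh]; simp⟩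
    | trans p q r _ _ ih1 ih2 =>
      obtain ⟨n, h1, h2⟩ := ih1
      obtain ⟨m, h3, h4⟩ := ih2
      exact ⟨m + n, by rw [h1, h3]; push_cast; ring, by rw [h4, h2, sh_sh]⟩
  · rintro ⟨n, rfl, rfl⟩
    exact Suspension.mk_add_intCast x s n

theorem Suspension.mk_add_eq_of_mk_eq {x y : X.carrier} {t s : ℝ}
    (h : Suspension.mk x t = Suspension.mk y s) (r : ℝ) :
    Suspension.mk x (t + r) = Suspension.mk y (s + r) := by
  obtain ⟨n, h1, h2⟩ := (Suspension.mk_eq_mk_iff _ _ _ _).1 h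
  exact (Suspension.mk_eq_mk_iff _ _ _ _).2 ⟨n, by rw [h1]; ring, h2⟩

theorem isOpenQuotientMap_suspension_mk :
    IsOpenQuotientMap fun p : X.carrier × ℝ => Suspension.mk p.1 p.2 := by
  refine ⟨fun p => ?_, continuous_suspension_mk, fun U hU => ?_⟩
  · obtain ⟨x, t, h⟩ := Suspension.exists_mk p
    exact ⟨(x, t), h⟩
  · refine isOpen_coinduced.2 ?_
    have : (Quot.mk (SuspRel X)) ⁻¹' ((fun p : X.carrier × ℝ => Suspension.mk p.1 p.2) '' U) =
        ⋃ n : ℤ, (fun p : X.carrier × ℝ => (sh n p.1, p.2 - n)) ⁻¹' U := by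
      ext ⟨x, t⟩
      simp only [mem_preimage, mem_iUnion]
      change (∃ p ∈ U, Suspension.mk p.1 p.2 = Suspension.mk x t) ↔ _
      constructor
      · rintro ⟨⟨y, s⟩, hU, h⟩
        obtain ⟨n, h1, h2⟩ := (Suspension.mk_eq_mk_iff x y t s).1 h.symm
        exact ⟨n, by simpa [h1, ← h2] using hU⟩
      · rintro ⟨n, h⟩
        exact ⟨(_, _), h, ((Suspension.mk_eq_mk_iff _ _ _ _).2 ⟨n, by ring, rfl⟩).symm⟩
    exact this ▸ isOpen_iUnion fun n => hU.preimage
      (((continuous_sh n).comp continuous_fst).prodMk (by fun_prop))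

instance [T2Space A] : T2Space (Suspension X) := by
  rw [t2Space_iff_of_isOpenQuotientMap isOpenQuotientMap_suspension_mk]
  have : {q : (X.carrier × ℝ) × (X.carrier × ℝ) |
      Suspension.mk q.1.1 q.1.2 = Suspension.mk q.2.1 q.2.2} =
      ⋃ n : ℤ, {q | q.1.2 = q.2.2 + (n : ℝ) ∧ q.2.1 = sh n q.1.1} := by
    ext q
    simp [Suspension.mk_eq_mk_iff]
  rw [this]
  refine LocallyFinite.isClosed_iUnion ?_ fun n => ?_
  -- The integer n is the difference of the two times, so only finitely many n matter near a given
  -- pair.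
  · intro q
    refine ⟨(fun q => q.1.2 - q.2.2) ⁻¹' Metric.ball (q.1.2 - q.2.2) 1,
      (by fun_prop : Continuous fun q : (X.carrier × ℝ) × (X.carrier × ℝ) =>
        q.1.2 - q.2.2).continuousAt.preimage_mem_nhds (Metric.ball_mem_nhds _ one_pos), ?_⟩
    refine (Set.finite_Icc ⌊q.1.2 - q.2.2 - 1⌋ ⌈q.1.2 - q.2.2 + 1⌉).subset ?_
    rintro n ⟨p, ⟨h1, -⟩, h2⟩
    simp only [mem_preimage, Metric.mem_ball, Real.dist_eq, abs_lt] at h2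
    constructor
    · have : ((⌊q.1.2 - q.2.2 - 1⌋ : ℤ) : ℝ) ≤ n :=
        (Int.floor_le _).trans (by linarith)
      exact_mod_cast this
    · have : (n : ℝ) ≤ (⌈q.1.2 - q.2.2 + 1⌉ : ℤ) :=
        le_trans (by linarith) (Int.le_ceil _)
      exact_mod_cast this
  · exact (isClosed_eq (by fun_prop) (by fun_prop)).inter
      (isClosed_eq (by fun_prop) ((continuous_sh n).comp (by fun_prop)))

end Suspension

/-! ### Birkhoff sums of the height function and the induced time change. -/

section Cumulative

variable {K : Type*} [TopologicalSpace K]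

theorem homeomorph_zpow_add_apply (T : K ≃ₜ K) (m n : ℤ) (c : K) :
    (T ^ (m + n)) c = (T ^ m) ((T ^ n) c) := by
  rw [zpow_add]; rfl

theorem homeomorph_zpow_add_one_apply (T : K ≃ₜ K) (n : ℤ) (c : K) :
    (T ^ (n + 1)) c = T ((T ^ n) c) := by
  rw [add_comm, homeomorph_zpow_add_apply, zpow_one]

/-- The Birkhoff sums of `r` along the orbits of `T`, for positive and negative times. -/
noncomputable def cum (T : K ≃ₜ K) (r : K → ℕ) (c : K) (n : ℤ) : ℤ :=
  ∑ i ∈ Finset.Ico 0 n, (r ((T ^ i) c) : ℤ) - ∑ i ∈ Finset.Ico n 0, (r ((T ^ i) c) : ℤ)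

/-- The piecewise linear interpolation of `cum`. -/
noncomputable def cumReal (T : K ≃ₜ K) (r : K → ℕ) (c : K) (t : ℝ) : ℝ :=
  cum T r c ⌊t⌋ + r ((T ^ ⌊t⌋) c) * Int.fract t

variable (T : K ≃ₜ K) (r : K → ℕ) (c : K)

@[simp] theorem cum_zero : cum T r c 0 = 0 := by simp [cum]

theorem cum_add_one (n : ℤ) : cum T r c (n + 1) = cum T r c n + r ((T ^ n) c) := by
  unfold cum
  rcases le_or_gt 0 n with h | h
  · rw [Finset.Ico_eq_empty_of_le h, Finset.Ico_eq_empty_of_le (by omega : (0 : ℤ) ≤ n + 1),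
      ← Finset.insert_Ico_right_eq_Ico_add_one h, Finset.sum_insert (by simp)]
    simp [add_comm]
  · rw [← Finset.insert_Ico_add_one_left_eq_Ico h, Finset.sum_insert (by simp),
      Finset.Ico_eq_empty_of_le h.le, Finset.Ico_eq_empty_of_le (by omega : n + 1 ≤ 0)]
    simp

theorem cum_sub_one (n : ℤ) : cum T r c (n - 1) = cum T r c n - r ((T ^ (n - 1)) c) := by
  have := cum_add_one T r c (n - 1)
  rw [sub_add_cancel] at this
  omega

theorem cumReal_of_mem_unitInterval (s : unitInterval) : cumReal T r c s = r c * s := by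
  -- At s = 1 the floor jumps to the next piece of the interpolation, which starts at the value r c.
  rcases s.2.2.eq_or_lt with h1 | h1
  · have := cum_add_one T r c 0
    rw [h1, cumReal]
    simp_all
  · rw [cumReal, Int.fract, Int.floor_eq_zero_iff.2 ⟨s.2.1, h1⟩]
    simp

variable {r} (hr : ∀ c, 0 < r c)
include hr

theorem sub_le_cum_sub {m n : ℤ} (h : m ≤ n) : n - m ≤ cum T r c n - cum T r c m := by
  induction n, h using Int.leInduction with
  | base => simp
  | succ n _ ih =>
    have := hr ((T ^ n) c)
    rw [cum_add_one]; omega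

theorem cum_mono : Monotone (cum T r c) := fun m n h => by
  have := sub_le_cum_sub T c hr h
  omega

/-- Heights are at least 1, so the sums are unbounded in both directions and cut the line into
half-open windows. -/
theorem exists_cum_le_lt (s : ℝ) : ∃ n, (cum T r c n : ℝ) ≤ s ∧ s < cum T r c (n + 1) := by
  obtain ⟨n, h1, h2⟩ := Int.exists_greatest_of_bdd (P := fun n => cum T r c n ≤ ⌊s⌋)
    ⟨max 0 ⌊s⌋, fun n h => by
      rcases le_total 0 n with h0 | h0
      · have := sub_le_cum_sub T c hr h0
        rw [cum_zero] at this
        exact le_max_of_le_right (by omega)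
      · exact le_max_of_le_left h0⟩
    ⟨min 0 ⌊s⌋, by
      have := sub_le_cum_sub T c hr (min_le_left 0 ⌊s⌋)
      have h3 := min_le_right 0 ⌊s⌋
      rw [cum_zero] at this
      omega⟩
  refine ⟨n, Int.le_floor.1 h1, ?_⟩
  by_contra! h
  have := h2 _ (Int.le_floor.2 h)
  omega

theorem cumReal_strictMono : StrictMono (cumReal T r c) := by
  intro s t h
  unfold cumReal
  have hp : ∀ n : ℤ, (0 : ℝ) < r ((T ^ n) c) := fun n => by exact_mod_cast hr _
  rcases (Int.floor_mono h.le).eq_or_lt with h1 | h1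
  · rw [h1]
    have : Int.fract s < Int.fract t := by
      rw [Int.fract, Int.fract, h1]; linarith
    have := mul_lt_mul_of_pos_left this (hp ⌊t⌋)
    linarith
  · have h2 : ((cum T r c (⌊s⌋ + 1) : ℤ) : ℝ) ≤ cum T r c ⌊t⌋ := by
      exact_mod_cast cum_mono T c hr (by omega : ⌊s⌋ + 1 ≤ ⌊t⌋)
    rw [cum_add_one] at h2
    push_cast at h2
    have h3 := mul_lt_mul_of_pos_left (Int.fract_lt_one s) (hp ⌊s⌋)
    have h4 := mul_nonneg (hp ⌊t⌋).le (Int.fract_nonneg t)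
    linarith

theorem cumReal_surjective : Function.Surjective (cumReal T r c) := by
  intro s
  obtain ⟨n, h1, h2⟩ := exists_cum_le_lt T c hr s
  have hp : (0 : ℝ) < r ((T ^ n) c) := by exact_mod_cast hr _
  rw [cum_add_one] at h2
  push_cast at h2
  have h0 : 0 ≤ (s - cum T r c n) / r ((T ^ n) c) := div_nonneg (by linarith) hp.le
  have h3 : (s - cum T r c n) / r ((T ^ n) c) < 1 := by
    rw [div_lt_one hp]; linarith
  refine ⟨n + (s - cum T r c n) / r ((T ^ n) c), ?_⟩
  have hf : ⌊(n : ℝ) + (s - cum T r c n) / r ((T ^ n) c)⌋ = n := by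
    rw [Int.floor_intCast_add, Int.floor_eq_zero_iff.2 ⟨h0, h3⟩, add_zero]
  unfold cumReal
  rw [Int.fract, hf]
  field_simp
  ring

end Cumulative

/-! ### Towers over a common base are flow equivalent. -/

section Tower

variable {A : Type u} [TopologicalSpace A] {K : Type*} [TopologicalSpace K]

/-- `X` is the tower of height `r` over the system `(K, T)`, with the base embedded by `ι`. -/
structure IsTower (X : Subshift A ℤ) (T : K ≃ₜ K) (r : K → ℕ) (ι : K → X.carrier) : Prop where
  continuous_base : Continuous ι
  continuous_height : Continuous r
  height_pos : ∀ c, 0 < r c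
  sh_height : ∀ c, sh (r c) (ι c) = ι (T c)
  eq_of_sh_eq : ∀ c c' (n : ℤ), 0 ≤ n → n < r c → sh n (ι c) = ι c' → n = 0 ∧ c = c'
  exists_sh : ∀ x, ∃ c, ∃ n : ℤ, 0 ≤ n ∧ n < r c ∧ sh n (ι c) = x

namespace IsTower

variable {X : Subshift A ℤ} {T : K ≃ₜ K} {r : K → ℕ} {ι : K → X.carrier}

theorem sh_cum (h : IsTower X T r ι) (c : K) (n : ℤ) :
    sh (cum T r c n) (ι c) = ι ((T ^ n) c) := by
  induction n using Int.induction_on with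
  | zero => simp
  | succ i ih =>
    rw [cum_add_one, add_comm, ← sh_sh, ih, h.sh_height, homeomorph_zpow_add_one_apply]
  | pred i ih =>
    apply sh_injective (r ((T ^ (-(i : ℤ) - 1)) c))
    rw [h.sh_height, ← homeomorph_zpow_add_one_apply, sub_add_cancel, ← ih, sh_sh, cum_sub_one]
    congr 1; ring

theorem mk_cumReal (h : IsTower X T r ι) (c : K) (t : ℝ) :
    Suspension.mk (ι c) (cumReal T r c t) =
      Suspension.mk (ι ((T ^ ⌊t⌋) c)) (r ((T ^ ⌊t⌋) c) * Int.fract t) := by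
  rw [cumReal, add_comm, Suspension.mk_add_intCast, h.sh_cum]

/-- Both times lie below the respective heights, so after a possible swap the integer relating the
two representatives lies in [0, r c), where `eq_of_sh_eq` leaves only 0. -/
theorem mk_mul_inj (h : IsTower X T r ι) {c c' : K} {s s' : ℝ} (hs : s ∈ Ico (0 : ℝ) 1)
    (hs' : s' ∈ Ico (0 : ℝ) 1)
    (he : Suspension.mk (ι c) (r c * s) = Suspension.mk (ι c') (r c' * s')) :
    c = c' ∧ s = s' := by
  obtain ⟨n, h1, h2⟩ := (Suspension.mk_eq_mk_iff _ _ _ _).1 he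
  have key : ∀ (c c' : K) (s s' : ℝ) (n : ℤ), s ∈ Ico (0 : ℝ) 1 → s' ∈ Ico (0 : ℝ) 1 → 0 ≤ n →
      r c * s = r c' * s' + n → ι c' = sh n (ι c) → c = c' ∧ s = s' := by
    intro c c' s s' n hs hs' hn h1 h2
    have hp : (0 : ℝ) < r c := by exact_mod_cast h.height_pos c
    have h3 : (n : ℝ) < r c := by
      have := mul_lt_mul_of_pos_left hs.2 hp
      have := mul_nonneg (Nat.cast_nonneg (α := ℝ) (r c')) hs'.1
      linarith
    obtain ⟨rfl, rfl⟩ := h.eq_of_sh_eq c c' n hn (by exact_mod_cast h3) h2.symm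
    refine ⟨rfl, ?_⟩
    simpa [hp.ne'] using h1
  rcases le_total 0 n with hn | hn
  · exact key c c' s s' n hs hs' hn h1 h2
  · have := key c' c s' s (-n) hs' hs (by omega) (by push_cast; linarith)
      (by rw [h2, sh_sh]; simp)
    exact ⟨this.1.symm, this.2.symm⟩

/-- The right-hand side involves neither X nor r nor ι: the gluing depends on (K, T) alone. -/
theorem mk_cumReal_eq_iff (h : IsTower X T r ι) (c c' : K) (t t' : ℝ) :
    Suspension.mk (ι c) (cumReal T r c t) = Suspension.mk (ι c') (cumReal T r c' t') ↔
      (T ^ ⌊t⌋) c = (T ^ ⌊t'⌋) c' ∧ Int.fract t = Int.fract t' := by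
  rw [h.mk_cumReal, h.mk_cumReal]
  exact ⟨h.mk_mul_inj ⟨Int.fract_nonneg _, Int.fract_lt_one _⟩
    ⟨Int.fract_nonneg _, Int.fract_lt_one _⟩, fun ⟨h1, h2⟩ => by rw [h1, h2]⟩

theorem exists_mk_eq (h : IsTower X T r ι) (p : Suspension X) :
    ∃ c t, Suspension.mk (ι c) (cumReal T r c t) = p := by
  obtain ⟨x, t, rfl⟩ := Suspension.exists_mk p
  obtain ⟨c, n, -, -, rfl⟩ := h.exists_sh x
  obtain ⟨s, hs⟩ := cumReal_surjective T c h.height_pos (t + n)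
  exact ⟨c, s, by rw [hs, Suspension.mk_add_intCast]⟩

/-- The parametrisation of the suspension by the base and the relative height. -/
def param (X : Subshift A ℤ) (r : K → ℕ) (ι : K → X.carrier) (p : K × unitInterval) :
    Suspension X :=
  Suspension.mk (ι p.1) (r p.1 * (p.2 : ℝ))

theorem mk_cumReal_eq_param (h : IsTower X T r ι) (c : K) (t : ℝ) :
    Suspension.mk (ι c) (cumReal T r c t) =
      param X r ι ((T ^ ⌊t⌋) c, ⟨Int.fract t, Int.fract_nonneg t, (Int.fract_lt_one t).le⟩) :=
  h.mk_cumReal c t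

/-- The floors are nonzero only at relative height 1, where (c, 1) is glued to (T c, 0). -/
theorem param_eq_iff (h : IsTower X T r ι) (p q : K × unitInterval) :
    param X r ι p = param X r ι q ↔
      (T ^ ⌊(p.2 : ℝ)⌋) p.1 = (T ^ ⌊(q.2 : ℝ)⌋) q.1 ∧
        Int.fract (p.2 : ℝ) = Int.fract (q.2 : ℝ) := by
  rw [← h.mk_cumReal_eq_iff, cumReal_of_mem_unitInterval, cumReal_of_mem_unitInterval]
  rfl

theorem continuous_param (h : IsTower X T r ι) : Continuous (param X r ι) := by
  refine continuous_suspension_mk.comp ((h.continuous_base.comp continuous_fst).prodMk ?_)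
  have := h.continuous_height
  have h2 : Continuous fun c => (r c : ℝ) := continuous_of_discreteTopology.comp this
  fun_prop

theorem param_surjective (h : IsTower X T r ι) : Function.Surjective (param X r ι) := by
  intro p
  obtain ⟨c, t, rfl⟩ := h.exists_mk_eq p
  exact ⟨_, (h.mk_cumReal_eq_param c t).symm⟩

/-- Both suspensions are quotients of the compact space K × [0, 1] by the same relation, so the
identity of K × [0, 1] descends to a continuous bijection from a compact space to a Hausdorff one.
-/
theorem flowEquivalent [CompactSpace K] [T2Space A] {B : Type u} [TopologicalSpace B] [T2Space B]
    {Y : Subshift B ℤ} {r' : K → ℕ} {ι' : K → Y.carrier}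
    (h : IsTower X T r ι) (h' : IsTower Y T r' ι') : FlowEquivalent X Y := by
  have hq : IsQuotientMap (param X r ι) :=
    h.continuous_param.isClosedMap.isQuotientMap h.continuous_param h.param_surjective
  have : CompactSpace (Suspension X) :=
    h.param_surjective.compactSpace h.continuous_param
  have hker : ∀ p q, param X r ι p = param X r ι q ↔ param Y r' ι' p = param Y r' ι' q :=
    fun p q => (h.param_eq_iff p q).trans (h'.param_eq_iff p q).symm
  obtain ⟨f, hf⟩ : ∃ f : C(Suspension X, Suspension Y),
      ∀ p, f (param X r ι p) = param Y r' ι' p := by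
    let g : C(K × unitInterval, Suspension X) := ⟨_, h.continuous_param⟩
    let g' : C(K × unitInterval, Suspension Y) := ⟨_, h'.continuous_param⟩
    have hg : IsQuotientMap g := hq
    have hfac : Function.FactorsThrough g' g := fun p q hpq => (hker p q).1 hpq
    exact ⟨hg.lift g' hfac, DFunLike.congr_fun (hg.lift_comp g' hfac)⟩
  have hbij : Function.Bijective f := by
    constructor
    · intro a b hab
      obtain ⟨p, rfl⟩ := h.param_surjective a
      obtain ⟨q, rfl⟩ := h.param_surjective b
      rw [hf, hf] at hab
      exact (hker p q).2 hab
    · intro b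
      obtain ⟨p, rfl⟩ := h'.param_surjective b
      exact ⟨_, hf p⟩
  have hfc : ∀ c t, f (Suspension.mk (ι c) (cumReal T r c t)) =
      Suspension.mk (ι' c) (cumReal T r' c t) := fun c t => by
    rw [h.mk_cumReal_eq_param, h'.mk_cumReal_eq_param, hf]
  refine ⟨Continuous.homeoOfEquivCompactToT2 (f := Equiv.ofBijective f hbij) f.continuous,
    fun x t => ?_⟩
  change ∃ φ : ℝ → ℝ, StrictMono φ ∧ ∀ (y : Y.carrier) (t' : ℝ),
    f (Suspension.mk x t) = Suspension.mk y t' →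
      ∀ r : ℝ, f (Suspension.mk x (t + r)) = Suspension.mk y (t' + φ r)
  obtain ⟨c, s, hcs⟩ := h.exists_mk_eq (Suspension.mk x t)
  let e := (cumReal_strictMono T c h.height_pos).orderIsoOfSurjective _
    (cumReal_surjective T c h.height_pos)
  have he : ∀ a, cumReal T r c (e.symm a) = a := e.apply_symm_apply
  -- Time in X is converted to base time by the inverse of `cumReal T r c`, then to time in Y by
  -- `cumReal T r' c`, both measured from the starting point s.
  refine ⟨fun a => cumReal T r' c (e.symm (cumReal T r c s + a)) - cumReal T r' c s, ?_, ?_⟩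
  · intro a b hab
    have := cumReal_strictMono T c h'.height_pos
      (e.symm.strictMono (by linarith : cumReal T r c s + a < cumReal T r c s + b))
    linarith
  · intro y t' hy a
    rw [← Suspension.mk_add_eq_of_mk_eq hcs a, ← he (cumReal T r c s + a), hfc]
    rw [← hcs, hfc] at hy
    rw [← Suspension.mk_add_eq_of_mk_eq hy]
    simp

end IsTower

end Tower

theorem ncard_range_le_of_factors {α β γ : Type*} (g : α → β) (h : α → γ) {s : Set γ}
    (hs : s.Finite) (hh : ∀ a, h a ∈ s) (hf : ∀ a b, h a = h b → g a = g b) :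
    (range g).ncard ≤ s.ncard := by
  rcases isEmpty_or_nonempty α with _ | ⟨⟨a₀⟩⟩
  · simp [range_eq_empty]
  · refine (ncard_le_ncard ?_ (hs.image (Function.extend h g fun _ => g a₀))).trans
      (ncard_image_le hs)
    rintro _ ⟨a, rfl⟩
    exact ⟨h a, hh a, Function.FactorsThrough.extend_apply (fun a b => hf a b) _ a⟩

/-! ### Towers of constant height as subshifts, and their entropy. -/

section Names

variable {K : Type*} [TopologicalSpace K] {D : Type u}

/-- The name of length `n` of a point: the symbols `d` reads along its `T`-orbit. -/
def names (T : K ≃ₜ K) (d : K → D) (n : ℕ) (c : K) : Fin n → D :=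
  fun i => d ((T ^ (i : ℤ)) c)

/-- The bi-infinite sequence read along the orbit of `c` slowed down by the factor `k`,
starting at level `j`. -/
def towerCode (T : K ≃ₜ K) (d : K → D) (k : ℕ) (c : K) (j : ℤ) : ℤ → ZMod k × D :=
  fun m => (((j + m : ℤ) : ZMod k), d ((T ^ ((j + m) / k)) c))

variable (T : K ≃ₜ K) (d : K → D) (k : ℕ) [NeZero k]

omit [NeZero k] in
theorem shift_towerCode (c : K) (j n : ℤ) :
    shift n (towerCode T d k c j) = towerCode T d k c (j + n) := by
  funext m
  simp [towerCode, shift, add_assoc]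

theorem towerCode_add_mul (c : K) (j n : ℤ) :
    towerCode T d k c (j + k * n) = towerCode T d k ((T ^ n) c) j := by
  funext m
  have hk : (k : ℤ) ≠ 0 := by exact_mod_cast NeZero.ne k
  simp only [towerCode]
  rw [← homeomorph_zpow_add_apply, show j + k * n + m = j + m + k * n by ring,
    Int.add_mul_ediv_left _ _ hk]
  simp

theorem towerCode_eq_emod (c : K) (j : ℤ) :
    towerCode T d k c j = towerCode T d k ((T ^ (j / k)) c) (j % k) := by
  rw [← towerCode_add_mul, Int.emod_add_mul_ediv]

variable [TopologicalSpace D]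

omit [NeZero k] in
theorem continuous_towerCode {d : K → D} (hd : Continuous d) (j : ℤ) :
    Continuous fun c => towerCode T d k c j :=
  continuous_pi fun m => continuous_const.prodMk (hd.comp (T ^ ((j + m) / k)).continuous)

/-- The subshift of all sequences read along orbits slowed down by the factor `k`. -/
def towerShift [CompactSpace K] [T2Space D] {d : K → D} (hd : Continuous d) :
    Subshift (ZMod k × D) ℤ where
  carrier := {y | ∃ c j, towerCode T d k c j = y}
  isClosed := by
    -- Levels 0 ≤ j < k suffice, so the carrier is a finite union of compact images.
    have : {y | ∃ c j, towerCode T d k c j = y} =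
        ⋃ j ∈ Ico (0 : ℤ) k, range fun c => towerCode T d k c j := by
      ext y
      simp only [mem_ofPred_eq, mem_iUnion, mem_range, exists_prop]
      constructor
      · rintro ⟨c, j, rfl⟩
        have hk : (0 : ℤ) < k := by exact_mod_cast NeZero.pos k
        exact ⟨j % k, ⟨Int.emod_nonneg _ hk.ne', Int.emod_lt_of_pos _ hk⟩, _,
          (towerCode_eq_emod T d k c j).symm⟩
      · rintro ⟨j, -, c, rfl⟩
        exact ⟨c, j, rfl⟩
    rw [this]
    exact (finite_Ico _ _).isClosed_biUnion fun j _ =>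
      (isCompact_range (continuous_towerCode T k hd j)).isClosed
  mapsTo := by
    rintro n _ ⟨c, j, rfl⟩
    exact ⟨c, j + n, (shift_towerCode T d k c j n).symm⟩

variable [CompactSpace K] [T2Space D] {d} (hd : Continuous d)

/-- The `ZMod k` coordinate records the level and so locates the base; `hgen` makes the coding of
the base injective. -/
theorem isTower_towerShift (hgen : ∀ c c', (∀ n : ℤ, d ((T ^ n) c) = d ((T ^ n) c')) → c = c') :
    IsTower (towerShift T k hd) T (fun _ => k) fun c => ⟨towerCode T d k c 0, c, 0, rfl⟩ where
  continuous_base := (continuous_towerCode T k hd 0).subtype_mk _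
  continuous_height := continuous_const
  height_pos _ := NeZero.pos k
  sh_height c := by
    apply Subtype.ext
    change shift _ (towerCode T d k c 0) = towerCode T d k (T c) 0
    rw [shift_towerCode]
    simpa using towerCode_add_mul T d k c 0 1
  eq_of_sh_eq c c' n h0 hn h := by
    have h : shift n (towerCode T d k c 0) = towerCode T d k c' 0 := congrArg Subtype.val h
    rw [shift_towerCode, zero_add] at h
    have h1 : (n : ZMod k) = ((0 : ℤ) : ZMod k) := by
      simpa [towerCode] using congrArg Prod.fst (congrFun h 0)
    rw [ZMod.intCast_eq_intCast_iff, Int.ModEq, Int.emod_eq_of_lt h0 hn, Int.zero_emod] at h1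
    subst h1
    refine ⟨rfl, hgen _ _ fun n => ?_⟩
    have hk : (k : ℤ) ≠ 0 := by exact_mod_cast NeZero.ne k
    simpa [towerCode, Int.mul_ediv_cancel_left _ hk] using
      congrArg Prod.snd (congrFun h (k * n))
  exists_sh := by
    rintro ⟨_, c, j, rfl⟩
    have hk : (0 : ℤ) < k := by exact_mod_cast NeZero.pos k
    refine ⟨(T ^ (j / k)) c, j % k, Int.emod_nonneg _ hk.ne', Int.emod_lt_of_pos _ hk, ?_⟩
    apply Subtype.ext
    change shift _ (towerCode T d k _ 0) = towerCode T d k c j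
    rw [shift_towerCode, zero_add, ← towerCode_eq_emod]

/-- The word of length `n` at the beginning of `towerCode T d k c j`. -/
def towerWord (T : K ≃ₜ K) (d : K → D) (k n : ℕ) (c : K) (j : ℤ) : List (ZMod k × D) :=
  List.ofFn fun i : Fin n => towerCode T d k c j (i : ℕ)

theorem blocks_towerShift (n : ℕ) :
    blocks (towerShift T k hd) n = range fun p : K × ℤ => towerWord T d k n p.1 p.2 := by
  ext w
  rw [mem_blocks_iff]
  constructor
  · rintro ⟨_, ⟨c, j, rfl⟩, i, rfl⟩
    refine ⟨(c, j + i), ?_⟩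
    simp only [towerWord, ← shift_towerCode]
    rfl
  · rintro ⟨⟨c, j⟩, rfl⟩
    exact ⟨_, ⟨c, j, rfl⟩, 0, by simp [towerWord]⟩

omit [NeZero k] [TopologicalSpace D] [CompactSpace K] [T2Space D] in
theorem towerWord_eq_iff (n : ℕ) (c c' : K) (j j' : ℤ) :
    towerWord T d k n c j = towerWord T d k n c' j' ↔
      ∀ i < n, towerCode T d k c j (i : ℤ) = towerCode T d k c' j' (i : ℤ) := by
  rw [towerWord, towerWord, List.ofFn_inj, funext_iff]
  exact ⟨fun h i hi => h ⟨i, hi⟩, fun h i => h i i.2⟩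

variable [Finite D]

/-- Sampling every k-th symbol of a word of length k * n recovers the name. -/
theorem ncard_names_le_ncard_blocks (n : ℕ) :
    (range (names T d n)).ncard ≤ (blocks (towerShift T k hd) (k * n)).ncard := by
  have hk : 0 < k := NeZero.pos k
  refine ncard_range_le_of_factors _ (fun c => towerWord T d k (k * n) c 0)
    (blocks_finite _ _) (fun c => ?_) fun c c' h => ?_
  · rw [blocks_towerShift]
    exact ⟨(c, 0), rfl⟩
  · rw [towerWord_eq_iff] at h
    funext i
    have := congrArg Prod.snd (h (k * i) (Nat.mul_lt_mul_of_pos_left i.2 hk))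
    simpa [towerCode, names, hk.ne'] using this

/-- A word of length k * n that starts at an arbitrary level meets at most n + 1 base points; with
the starting level their name determines it. -/
theorem ncard_blocks_le_ncard_names (n : ℕ) :
    (blocks (towerShift T k hd) (k * n)).ncard ≤ k * (range (names T d (n + 1))).ncard := by
  have hk : (0 : ℤ) < k := by exact_mod_cast NeZero.pos k
  have : k * (range (names T d (n + 1))).ncard =
      ((univ : Set (ZMod k)) ×ˢ range (names T d (n + 1))).ncard := by
    rw [ncard_prod, ncard_univ, Nat.card_zmod]
  rw [this, blocks_towerShift]
  refine ncard_range_le_of_factors _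
    (fun p : K × ℤ => ((p.2 : ZMod k), names T d (n + 1) ((T ^ (p.2 / k)) p.1))) (toFinite _)
    (fun p => ⟨mem_univ _, _, rfl⟩) ?_
  rintro ⟨c, j⟩ ⟨c', j'⟩ h
  simp only [Prod.mk.injEq, ZMod.intCast_eq_intCast_iff] at h
  obtain ⟨h1, h2⟩ := h
  rw [towerWord_eq_iff]
  intro i hi
  rw [towerCode_eq_emod T d k c, towerCode_eq_emod T d k c', ← h1]
  have h3 := Int.emod_nonneg j hk.ne'
  have h4 := Int.emod_lt_of_pos j hk
  have h5 : 0 ≤ (j % k + i) / (k : ℤ) := Int.ediv_nonneg (by omega) hk.le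
  have h6 : (j % k + i) / (k : ℤ) < (n + 1 : ℕ) := by
    rw [Int.ediv_lt_iff_lt_mul hk]
    have : (i : ℤ) < k * n := by exact_mod_cast hi
    push_cast
    nlinarith
  obtain ⟨a, ha⟩ := Int.eq_ofNat_of_zero_le h5
  have := congrFun h2 ⟨a, by omega⟩
  simpa [towerCode, names, ha] using this

theorem ncard_blocks_one (n : ℕ) :
    (blocks (towerShift T 1 hd) n).ncard = (range (names T d n)).ncard := by
  refine le_antisymm ?_ (by simpa using ncard_names_le_ncard_blocks T 1 hd n)
  rw [blocks_towerShift]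
  refine ncard_range_le_of_factors _ (fun p => names T d n ((T ^ p.2) p.1)) (toFinite _)
    (fun p => ⟨_, rfl⟩) ?_
  rintro ⟨c, j⟩ ⟨c', j'⟩ h
  rw [towerWord_eq_iff]
  intro i hi
  rw [towerCode_eq_emod T d 1 c, towerCode_eq_emod T d 1 c']
  simpa [towerCode, names] using congrFun h ⟨i, hi⟩

theorem tendsto_logb_ncard_names :
    Tendsto (fun n : ℕ => Real.logb 2 ((range (names T d n)).ncard : ℝ) / n) atTop
      (𝓝 (entropy (towerShift T 1 hd))) := by
  simpa only [ncard_blocks_one] using tendsto_entropy (towerShift T 1 hd)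

/-- Abramov's formula for a constant height: the two counting bounds squeeze the growth rate along
the lengths k * n. -/
theorem entropy_towerShift [Nonempty K] :
    entropy (towerShift T k hd) = entropy (towerShift T 1 hd) / k := by
  have hk : 0 < k := NeZero.pos k
  have hk' : (0 : ℝ) < k := by exact_mod_cast hk
  set W : ℕ → ℝ := fun n => ((range (names T d n)).ncard : ℝ) with hW
  have hWpos : ∀ n, 0 < W n := fun n => by
    exact Nat.cast_pos.2 <| (ncard_pos (toFinite _)).2 (range_nonempty (names T d n))
  have hL : Tendsto (fun n : ℕ => Real.logb 2 (W n) / n) atTop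
    (𝓝 (entropy (towerShift T 1 hd))) := tendsto_logb_ncard_names T hd
  have h1 : Tendsto (fun n : ℕ => k * n) atTop atTop := tendsto_id.const_mul_atTop' hk
  have hE := (tendsto_entropy (towerShift T k hd)).comp h1
  refine tendsto_nhds_unique hE ?_
  have hlow := hL.div_const (k : ℝ)
  have hup : Tendsto (fun n : ℕ => Real.logb 2 k / k * (1 / (n : ℝ)) +
      Real.logb 2 (W (n + 1)) / ((n + 1 : ℕ) : ℝ) * (1 + 1 / (n : ℝ)) / k) atTop
      (𝓝 (entropy (towerShift T 1 hd) / k)) := by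
    have h2 : Tendsto (fun n : ℕ => 1 / (n : ℝ)) atTop (𝓝 0) := tendsto_one_div_atTop_nhds_zero_nat
    have h3 := (tendsto_add_atTop_iff_nat (f := fun n : ℕ => Real.logb 2 (W n) / n) 1).2 hL
    simpa using (h2.const_mul (Real.logb 2 k / k)).add ((h3.mul (h2.const_add 1)).div_const (k : ℝ))
  refine tendsto_of_tendsto_of_tendsto_of_le_of_le' hlow hup ?_ ?_
  · filter_upwards [eventually_gt_atTop 0] with n hn
    have hn' : (0 : ℝ) < n := by exact_mod_cast hn
    have h2 : W n ≤ (blocks (towerShift T k hd) (k * n)).ncard := by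
      exact Nat.cast_le.2 <| ncard_names_le_ncard_blocks T k hd n
    have h3 := Real.logb_le_logb_of_le one_lt_two (hWpos n) h2
    simp only [Function.comp]
    rw [div_div, mul_comm (n : ℝ)]
    push_cast
    gcongr
  · filter_upwards [eventually_gt_atTop 0] with n hn
    have hn' : (0 : ℝ) < n := by exact_mod_cast hn
    have h2 : W n ≤ (blocks (towerShift T k hd) (k * n)).ncard := by
      exact Nat.cast_le.2 <| ncard_names_le_ncard_blocks T k hd n
    have h4 : ((blocks (towerShift T k hd) (k * n)).ncard : ℝ) ≤ k * W (n + 1) := by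
      rw [hW, ← Nat.cast_mul]
      exact Nat.cast_le.2 <| ncard_blocks_le_ncard_names T k hd n
    have h3 := Real.logb_le_logb_of_le one_lt_two ((hWpos n).trans_le h2) h4
    rw [Real.logb_mul hk'.ne' (hWpos _).ne'] at h3
    simp only [Function.comp]
    push_cast
    rw [div_le_iff₀ (by positivity)]
    refine h3.trans (le_of_eq ?_)
    field_simp

end Names

theorem cum_congr {K : Type*} [TopologicalSpace K] (T : K ≃ₜ K) (r : K → ℕ) {c c' : K} {n : ℤ}
    (h : ∀ i, min 0 n ≤ i → i < max 0 n → r ((T ^ i) c) = r ((T ^ i) c')) :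
    cum T r c n = cum T r c' n := by
  unfold cum
  congr 1 <;> refine Finset.sum_congr rfl fun i hi => ?_ <;> rw [Finset.mem_Ico] at hi <;>
    rw [h i (by omega) (by omega)]

/-! ### First return maps to clopen syndetic sets. -/

section Return

variable {A : Type u} [TopologicalSpace A] {X : Subshift A ℤ}

instance [Finite A] : CompactSpace X.carrier :=
  isCompact_iff_compactSpace.1 X.isClosed.isCompact

/-- `C` is visited by every orbit within every time window of length `N`. -/
def Syndetic (C : Set X.carrier) (N : ℕ) : Prop :=
  ∀ x, ∃ i : ℕ, i < N ∧ sh i x ∈ C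

variable {C : Set X.carrier} {N : ℕ} (hN : Syndetic C N)

namespace Syndetic

include hN in
theorem exists_forward (x : X.carrier) : ∃ i : ℕ, 0 < i ∧ sh i x ∈ C := by
  obtain ⟨i, -, hi⟩ := hN (sh 1 x)
  exact ⟨i + 1, by omega, by rw [sh_sh] at hi; exact_mod_cast hi⟩

include hN in
theorem exists_backward (x : X.carrier) : ∃ i : ℕ, 0 < i ∧ sh (-(i : ℤ)) x ∈ C := by
  -- Starting N steps in the past, the visit at offset i < N still has strictly negative time i − N.
  obtain ⟨i, hiN, hi⟩ := hN (sh (-(N : ℤ)) x)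
  refine ⟨N - i, by omega, ?_⟩
  rw [sh_sh] at hi
  rwa [show -((N - i : ℕ) : ℤ) = i + -(N : ℤ) by omega]

open Classical in
/-- The time until the next visit to `C`. -/
noncomputable def ret (x : X.carrier) : ℕ := Nat.find (hN.exists_forward x)

open Classical in
/-- The time since the previous visit to `C`. -/
noncomputable def back (x : X.carrier) : ℕ := Nat.find (hN.exists_backward x)

theorem ret_pos (x : X.carrier) : 0 < hN.ret x := by
  classical exact (Nat.find_spec (hN.exists_forward x)).1

theorem back_pos (x : X.carrier) : 0 < hN.back x := by
  classical exact (Nat.find_spec (hN.exists_backward x)).1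

theorem sh_ret_mem (x : X.carrier) : sh (hN.ret x) x ∈ C := by
  classical exact (Nat.find_spec (hN.exists_forward x)).2

theorem sh_neg_back_mem (x : X.carrier) : sh (-(hN.back x : ℤ)) x ∈ C := by
  classical exact (Nat.find_spec (hN.exists_backward x)).2

theorem ret_le_of_mem {x : X.carrier} {i : ℕ} (hi : 0 < i) (h : sh i x ∈ C) : hN.ret x ≤ i := by
  classical exact Nat.find_min' (hN.exists_forward x) ⟨hi, h⟩

theorem back_le_of_mem {x : X.carrier} {i : ℕ} (hi : 0 < i) (h : sh (-(i : ℤ)) x ∈ C) :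
    hN.back x ≤ i := by
  classical exact Nat.find_min' (hN.exists_backward x) ⟨hi, h⟩

theorem ret_le (x : X.carrier) : hN.ret x ≤ N := by
  obtain ⟨i, hi, h⟩ := hN (sh 1 x)
  rw [sh_sh] at h
  exact (hN.ret_le_of_mem (Nat.succ_pos i) (by exact_mod_cast h)).trans hi

theorem back_sh_ret {x : X.carrier} (hx : x ∈ C) : hN.back (sh (hN.ret x) x) = hN.ret x := by
  refine le_antisymm (hN.back_le_of_mem (hN.ret_pos x) (by simpa [sh_sh] using hx)) ?_
  by_contra! h
  have h1 := hN.sh_neg_back_mem (sh (hN.ret x) x)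
  have h2 := hN.back_pos (sh (hN.ret x) x)
  rw [sh_sh] at h1
  have := hN.ret_le_of_mem (x := x) (i := hN.ret x - hN.back (sh (hN.ret x) x)) (by omega)
    (by convert h1 using 2; omega)
  omega

theorem ret_sh_neg_back {x : X.carrier} (hx : x ∈ C) :
    hN.ret (sh (-(hN.back x : ℤ)) x) = hN.back x := by
  refine le_antisymm (hN.ret_le_of_mem (hN.back_pos x) (by simpa [sh_sh] using hx)) ?_
  by_contra! h
  have h1 := hN.sh_ret_mem (sh (-(hN.back x : ℤ)) x)
  have h2 := hN.ret_pos (sh (-(hN.back x : ℤ)) x)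
  rw [sh_sh] at h1
  have := hN.back_le_of_mem (x := x) (i := hN.back x - hN.ret (sh (-(hN.back x : ℤ)) x))
    (by omega) (by convert h1 using 2; omega)
  omega

/-- The first return map. -/
noncomputable def returnEquiv : C ≃ C where
  toFun c := ⟨_, hN.sh_ret_mem c.1⟩
  invFun c := ⟨_, hN.sh_neg_back_mem c.1⟩
  left_inv c := by
    apply Subtype.ext
    simp only [hN.back_sh_ret c.2, sh_sh]
    simp
  right_inv c := by
    apply Subtype.ext
    simp only [hN.ret_sh_neg_back c.2, sh_sh]
    simp

/-- Whether the return time equals b depends on finitely many visit conditions, each of them clopen.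
-/
theorem continuous_ret (hC : IsClopen C) : Continuous hN.ret := by
  refine continuous_discrete_rng.2 fun b => ?_
  have : hN.ret ⁻¹' {b} = {_x | 0 < b} ∩ (sh (b : ℤ) ⁻¹' C ∩
      ⋂ m ∈ Ioo 0 b, (sh ((m : ℕ) : ℤ) ⁻¹' C)ᶜ) := by
    ext x
    simp only [mem_preimage, mem_singleton_iff, mem_inter_iff, mem_iInter, mem_compl_iff]
    constructor
    · rintro rfl
      exact ⟨hN.ret_pos x, hN.sh_ret_mem x, fun m hm h =>
        (hN.ret_le_of_mem hm.1 h).not_gt hm.2⟩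
    · rintro ⟨h0, h1, h2⟩
      refine le_antisymm (hN.ret_le_of_mem h0 h1) ?_
      by_contra! h
      exact h2 _ ⟨hN.ret_pos x, h⟩ (hN.sh_ret_mem x)
  rw [this]
  exact isOpen_const.inter ((hC.2.preimage (continuous_sh _)).inter
    ((finite_Ioo 0 b).isOpen_biInter fun m _ => (hC.1.preimage (continuous_sh _)).isOpen_compl))

theorem continuous_returnEquiv (hC : IsClopen C) : Continuous hN.returnEquiv := by
  have h : Continuous fun p : ℕ × X.carrier => sh (p.1 : ℤ) p.2 :=
    continuous_prod_of_discrete_left.2 fun n => continuous_sh (n : ℤ)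
  exact (h.comp ((((hN.continuous_ret hC).comp continuous_subtype_val)).prodMk
    continuous_subtype_val)).subtype_mk _

variable [Finite A] [DiscreteTopology A] (hC : IsClopen C)

omit [DiscreteTopology A] in
theorem _root_.FlowShift.compactSpace_of_isClopen {C : Set X.carrier} (hC : IsClopen C) :
    CompactSpace C :=
  isCompact_iff_compactSpace.1 hC.1.isCompact

/-- The first return map as a homeomorphism. -/
noncomputable def returnHomeo : C ≃ₜ C :=
  haveI := compactSpace_of_isClopen hC
  (hN.continuous_returnEquiv hC).homeoOfEquivCompactToT2

theorem isTower : IsTower X (hN.returnHomeo hC) (fun c => hN.ret c.1) Subtype.val where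
  continuous_base := continuous_subtype_val
  continuous_height := (hN.continuous_ret hC).comp continuous_subtype_val
  height_pos c := hN.ret_pos c.1
  sh_height c := rfl
  eq_of_sh_eq c c' n h0 hn h := by
    obtain ⟨m, rfl⟩ := Int.eq_ofNat_of_zero_le h0
    have : m = 0 := by
      by_contra! hm
      have := hN.ret_le_of_mem (Nat.pos_of_ne_zero hm) (h ▸ c'.2 : sh (m : ℤ) c.1 ∈ C)
      omega
    subst this
    exact ⟨rfl, Subtype.ext (by simpa using h)⟩
  exists_sh x := by
    -- The last visit strictly before σ x is the last visit at time ≤ 0 of x, so a point of C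
    -- becomes its own base point at level 0.
    have hb := hN.back_pos (sh 1 x)
    refine ⟨⟨_, hN.sh_neg_back_mem (sh 1 x)⟩, hN.back (sh 1 x) - 1, by omega, ?_, ?_⟩
    · change _ < (hN.ret (sh (-(hN.back (sh 1 x) : ℤ)) (sh 1 x)) : ℤ)
      by_contra! h
      have h1 := hN.sh_ret_mem (sh (-(hN.back (sh 1 x) : ℤ)) (sh 1 x))
      have h2 := hN.ret_pos (sh (-(hN.back (sh 1 x) : ℤ)) (sh 1 x))
      rw [sh_sh] at h1
      have := hN.back_le_of_mem (x := sh 1 x)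
        (i := hN.back (sh 1 x) - hN.ret (sh (-(hN.back (sh 1 x) : ℤ)) (sh 1 x)))
        (by omega) (by convert h1 using 2; omega)
      omega
    · change sh _ (sh _ (sh 1 x)) = x
      simp [sh_sh]

/-- A return time together with a block covering the return time. -/
noncomputable def returnBlock (c : C) : Fin (N + 1) × (Fin N → A) :=
  (⟨hN.ret c.1, Nat.lt_succ_of_le (hN.ret_le c.1)⟩, fun i => c.1.1 (i : ℕ))

omit [Finite A] [DiscreteTopology A] in
theorem continuous_returnBlock (hC : IsClopen C) : Continuous hN.returnBlock := by
  refine Continuous.prodMk ?_ (continuous_pi fun i =>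
    (continuous_apply _).comp (continuous_subtype_val.comp continuous_subtype_val))
  have := (hN.continuous_ret hC).comp (continuous_subtype_val (p := (· ∈ C)))
  refine continuous_discrete_rng.2 fun b => ?_
  convert (isOpen_discrete {(b : ℕ)}).preimage this using 1
  ext c
  simp [Fin.ext_iff]

omit [Finite A] [DiscreteTopology A] in
theorem ret_eq_of_returnBlock_eq {c c' : C} (h : hN.returnBlock c = hN.returnBlock c') :
    hN.ret c.1 = hN.ret c'.1 :=
  congrArg (fun p => (p.1 : ℕ)) h

/-- The times of the visits to `C`. -/
noncomputable def visit (c : C) (n : ℤ) : ℤ :=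
  cum (hN.returnHomeo hC) (fun c => hN.ret c.1) c n

/-- Position m lies in the n-th return window at an offset below the return time, hence below N, and
is read off the block stored there. -/
theorem apply_eq_of_returnBlock_eq {c c' : C} {n m : ℤ}
    (hcum : hN.visit hC c n = hN.visit hC c' n)
    (hd : hN.returnBlock ((hN.returnHomeo hC ^ n) c) = hN.returnBlock ((hN.returnHomeo hC ^ n) c'))
    (h1 : hN.visit hC c n ≤ m) (h2 : m < hN.visit hC c (n + 1)) : c.1.1 m = c'.1.1 m := by
  have h3 : hN.visit hC c (n + 1) = hN.visit hC c n + _ := cum_add_one _ _ c n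
  have h4 := hN.ret_le ((hN.returnHomeo hC ^ n) c).1
  obtain ⟨i, hi⟩ := Int.eq_ofNat_of_zero_le (sub_nonneg.2 h1)
  have h5 : ∀ c, (((hN.returnHomeo hC ^ n) c).1).1 (i : ℤ) = c.1.1 (hN.visit hC c n + i) :=
    fun c => by
      rw [← (hN.isTower hC).sh_cum c n]
      rfl
  have h6 := congrFun (congrArg Prod.snd hd) ⟨i, by omega⟩
  simp only [returnBlock, h5, ← hcum] at h6
  rwa [show hN.visit hC c n + (i : ℤ) = m by omega] at h6

/-- Return times are part of the blocks, so equal blocks align the windows. This is the generating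
hypothesis of `isTower_towerShift`. -/
theorem eq_of_returnBlock_eq {c c' : C} (h : ∀ n : ℤ,
    hN.returnBlock ((hN.returnHomeo hC ^ n) c) = hN.returnBlock ((hN.returnHomeo hC ^ n) c')) :
    c = c' := by
  apply Subtype.ext
  apply Subtype.ext
  funext m
  obtain ⟨n, h1, h2⟩ := exists_cum_le_lt (hN.returnHomeo hC) c (hN.isTower hC).height_pos m
  exact hN.apply_eq_of_returnBlock_eq hC
    (cum_congr _ _ fun i _ _ => hN.ret_eq_of_returnBlock_eq (h i)) (h n)
    (by exact_mod_cast h1) (by exact_mod_cast h2)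

theorem apply_eq_of_names_eq {c c' : C} {n : ℕ}
    (h : names (hN.returnHomeo hC) hN.returnBlock n c =
      names (hN.returnHomeo hC) hN.returnBlock n c') {m : ℤ} (h0 : 0 ≤ m)
    (hm : m < hN.visit hC c n) : c.1.1 m = c'.1.1 m := by
  have h' : ∀ i : ℤ, 0 ≤ i → i < n → hN.returnBlock ((hN.returnHomeo hC ^ i) c) =
      hN.returnBlock ((hN.returnHomeo hC ^ i) c') := by
    intro i h0 hi
    obtain ⟨j, rfl⟩ := Int.eq_ofNat_of_zero_le h0
    exact congrFun h ⟨j, by omega⟩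
  have hpos := (hN.isTower hC).height_pos
  obtain ⟨a, h1, h2⟩ := exists_cum_le_lt (hN.returnHomeo hC) c hpos m
  have h1 : hN.visit hC c a ≤ m := by exact_mod_cast h1
  have h2 : m < hN.visit hC c (a + 1) := by exact_mod_cast h2
  have hmono : Monotone (hN.visit hC c) := cum_mono _ c hpos
  have hzero : hN.visit hC c 0 = 0 := cum_zero _ _ _
  have ha0 : 0 ≤ a := by
    by_contra! hlt
    have := hmono (by omega : a + 1 ≤ 0)
    omega
  have han : a < n := by
    by_contra! hlt
    have := hmono hlt
    omega
  exact hN.apply_eq_of_returnBlock_eq hC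
    (cum_congr _ _ fun i hi hi' => hN.ret_eq_of_returnBlock_eq (h' i (by omega) (by omega)))
    (h' a ha0 han) h1 h2

/-- Otherwise the n + 1 distinct visit times with indices 0, …, n would all lie in [0, Q), hence in
V. -/
theorem le_visit_of_card_le {c : C} {n : ℕ} {Q : ℤ} {V : Finset ℤ}
    (hV : ∀ m, 0 ≤ m → m < Q → sh m c.1 ∈ C → m ∈ V) (hcard : V.card ≤ n) :
    Q ≤ hN.visit hC c n := by
  by_contra! h
  have hpos := (hN.isTower hC).height_pos
  have hmono : Monotone (hN.visit hC c) := cum_mono _ c hpos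
  have hzero : hN.visit hC c 0 = 0 := cum_zero _ _ _
  have : (Finset.range (n + 1)).card ≤ V.card := by
    refine Finset.card_le_card_of_injOn (fun i => hN.visit hC c i) (fun i hi => ?_) ?_
    · rw [Finset.coe_range, mem_Iio] at hi
      have h1 := hmono (by omega : (0 : ℤ) ≤ i)
      have h2 := hmono (by omega : (i : ℤ) ≤ n)
      refine hV (hN.visit hC c i) (by omega) (by omega) ?_
      rw [visit, (hN.isTower hC).sh_cum]
      exact Subtype.prop _
    · intro i _ j _ hij
      have hij : hN.visit hC c i = hN.visit hC c j := hij
      rcases lt_trichotomy i j with h | h | h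
      · have := sub_le_cum_sub (hN.returnHomeo hC) c hpos (by omega : (i : ℤ) ≤ j)
        simp only [visit] at hij
        omega
      · exact h
      · have := sub_le_cum_sub (hN.returnHomeo hC) c hpos (by omega : (j : ℤ) ≤ i)
        simp only [visit] at hij
        omega
  simp at this
  omega

/-- If n returns take at least Q steps, a name of length n determines the first Q symbols. Rare
visits thus force many names. -/
theorem card_le_ncard_names {S : Type*} {n : ℕ} {Q : ℤ} (p : S → C)
    (hQ : ∀ s, Q ≤ hN.visit hC (p s) n)
    (hp : ∀ s s', (∀ m, 0 ≤ m → m < Q → (p s).1.1 m = (p s').1.1 m) → s = s') :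
    Nat.card S ≤ (range (names (hN.returnHomeo hC) hN.returnBlock n)).ncard := by
  rw [← ncard_univ]
  refine ncard_le_ncard_of_injOn (fun s => names (hN.returnHomeo hC) hN.returnBlock n (p s))
    (fun s _ => ⟨_, rfl⟩) (fun s _ s' _ h => hp s s' fun m h0 hm => ?_) (toFinite _)
  exact hN.apply_eq_of_names_eq hC h h0 (hm.trans_le (hQ s))

/-- If every orbit visits `C` syndetically, then all fractions `L / k` of the entropy `L` of the
first return system are entropies of subshifts flow equivalent to `X`. -/
theorem exists_flowEntropies [Nonempty C] :
    ∃ L : ℝ, Tendsto (fun n : ℕ => Real.logb 2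
      ((range (names (hN.returnHomeo hC) hN.returnBlock n)).ncard : ℝ) / n) atTop (𝓝 L) ∧
      ∀ k : ℕ, 0 < k → L / k ∈ flowEntropies X := by
  have := compactSpace_of_isClopen hC
  have hd := hN.continuous_returnBlock hC
  refine ⟨entropy (towerShift (hN.returnHomeo hC) 1 hd),
    tendsto_logb_ncard_names _ hd, fun k hk => ?_⟩
  have : NeZero k := ⟨hk.ne'⟩
  refine ⟨ZMod k × (Fin (N + 1) × (Fin N → A)), inferInstance, inferInstance, inferInstance,
    towerShift (hN.returnHomeo hC) k hd, ?_, entropy_towerShift _ k hd⟩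
  exact (hN.isTower hC).flowEquivalent
    (isTower_towerShift _ k hd fun c c' h => hN.eq_of_returnBlock_eq hC h)

end Syndetic

end Return

/-! ### Walks in labelled graphs and polynomial growth. -/

namespace LabeledGraph

variable {A : Type u} (G : LabeledGraph A)

instance : Finite G.V := G.finite_V

instance : Finite G.E := G.finite_E

/-- `G.WalkIn S p w q`: some walk from `p` to `q` with label `w` visits only vertices in `S`. -/
inductive WalkIn (S : Set G.V) : G.V → List A → G.V → Prop
  | nil {p} : p ∈ S → WalkIn S p [] p
  | cons (e : G.E) {w q} : G.source e ∈ S → WalkIn S (G.target e) w q →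
      WalkIn S (G.source e) (G.label e :: w) q

variable {G}

theorem WalkIn.source_mem {S : Set G.V} {p q : G.V} {w : List A} (h : G.WalkIn S p w q) :
    p ∈ S := by
  cases h <;> assumption

/-- Cutting a walk at its last visit to a vertex. -/
theorem WalkIn.avoid_or_split {S : Set G.V} {p q : G.V} {w : List A} (h : G.WalkIn S p w q)
    (v : G.V) : G.WalkIn (S \ {v}) p w q ∨ ∃ w₁ w₂, w = w₁ ++ w₂ ∧ G.WalkIn S p w₁ v ∧
      (w₂ = [] ∨ ∃ a w₃ p' q', w₂ = a :: w₃ ∧ G.WalkIn (S \ {v}) p' w₃ q') := by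
  induction h with
  | @nil p hp =>
    by_cases hv : p = v
    · subst hv
      exact .inr ⟨[], [], rfl, .nil hp, .inl rfl⟩
    · exact .inl (.nil ⟨hp, hv⟩)
  | @cons e w q hp _ ih =>
    rcases ih with ih | ⟨w₁, w₂, rfl, h1, h2⟩
    · by_cases hv : G.source e = v
      · subst hv
        exact .inr ⟨[], _, rfl, .nil hp, .inr ⟨_, _, _, _, rfl, ih⟩⟩
      · exact .inl (.cons e ⟨hp, hv⟩ ih)
    · exact .inr ⟨_ :: w₁, w₂, rfl, .cons e hp h1, h2⟩

theorem walkIn_ofFn {e : ℤ → G.E} (he : e ∈ G.edgeShift) (n : ℕ) (i : ℤ) :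
    G.WalkIn univ (G.source (e i)) (List.ofFn fun k : Fin n => G.label (e (i + (k : ℕ))))
      (G.source (e (i + n))) := by
  induction n generalizing i with
  | zero => simpa using WalkIn.nil (mem_univ _)
  | succ n ih =>
    rw [List.ofFn_succ]
    have := ih (i + 1)
    rw [← he i] at this
    have hk : ∀ k : ℤ, i + 1 + k = i + (k + 1) := fun k => by ring
    simp only [hk] at this
    simpa using WalkIn.cons (e i) (mem_univ _) this

theorem WalkIn.exists_edges [Nonempty G.E] {S : Set G.V} {p q : G.V} {w : List A}
    (h : G.WalkIn S p w q) : ∃ (f : ℕ → G.E) (g : ℕ → G.V), g 0 = p ∧ g w.length = q ∧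
      ∀ i (hi : i < w.length), G.source (f i) = g i ∧ G.target (f i) = g (i + 1) ∧
        G.label (f i) = w[i] := by
  induction h with
  | @nil p _ => exact ⟨fun _ => Classical.arbitrary _, fun _ => p, by simp⟩
  | @cons e w q _ _ ih =>
    obtain ⟨f, g, h0, hq, h⟩ := ih
    refine ⟨fun i => Nat.casesOn i e f, fun i => Nat.casesOn i (G.source e) g, rfl, hq, ?_⟩
    rintro (_ | i) hi
    · exact ⟨rfl, h0.symm, rfl⟩
    · exact h i (by simpa using hi)

/-- If cycles are determined by their base point and length, then the number of labels of walks
grows polynomially. -/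
theorem exists_polynomial_bound [Finite A] [Nonempty G.V]
    (huniq : ∀ p w w', w.length = w'.length → G.WalkIn univ p w p → G.WalkIn univ p w' p → w = w')
    (n d : ℕ) : ∃ U : Set (List A), U.Finite ∧
      U.ncard ≤ (Nat.card G.V * (Nat.card A + 1) * (n + 1)) ^ d ∧ [] ∈ U ∧
      ∀ S : Set G.V, S.ncard ≤ d → ∀ p w q, G.WalkIn S p w q → w.length ≤ n → w ∈ U := by
  have mono : ∀ {S : Set G.V} {p w q}, G.WalkIn S p w q → G.WalkIn univ p w q := by
    intro S p w q h
    induction h with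
    | nil _ => exact .nil trivial
    | cons e _ _ ih => exact .cons e trivial ih
  -- By `huniq` a base point and a length determine the label of a cycle; the value is `[]` where no
  -- such cycle exists.
  obtain ⟨cyc, hcyc⟩ : ∃ cyc : G.V → ℕ → List A,
      ∀ p w, G.WalkIn univ p w p → cyc p w.length = w := by
    classical
    refine ⟨fun p k => if h : ∃ w, w.length = k ∧ G.WalkIn univ p w p then h.choose else [],
      fun p w hw => ?_⟩
    have h : ∃ w', w'.length = w.length ∧ G.WalkIn univ p w' p := ⟨w, rfl, hw⟩
    simp only [dif_pos h]
    exact huniq p _ _ h.choose_spec.1 h.choose_spec.2 hw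
  induction d with
  | zero =>
    refine ⟨{[]}, finite_singleton _, by simp, rfl, fun S hS p w q h => ?_⟩
    rw [Nat.le_zero, ncard_eq_zero (toFinite S)] at hS
    exact absurd h.source_mem (by simp [hS])
  | succ d ih =>
    obtain ⟨U, hU, hcard, h0, hmem⟩ := ih
    have hfin := (finite_univ (α := G.V)).prod ((finite_Iio (n + 1)).prod
      ((finite_univ (α := Option A)).prod hU))
    -- A word is a cycle at p, then either nothing (`none`) or one letter and a word of a walk
    -- avoiding p, which has one vertex fewer available.
    refine ⟨(fun x : G.V × ℕ × Option A × List A =>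
      cyc x.1 x.2.1 ++ x.2.2.1.elim [] fun a => a :: x.2.2.2) ''
      (univ ×ˢ Iio (n + 1) ×ˢ univ ×ˢ U), hfin.image _, ?_, ?_, ?_⟩
    · refine (ncard_image_le hfin).trans ?_
      rw [ncard_prod, ncard_prod, ncard_prod, ncard_univ, ncard_univ, Finite.card_option,
        ncard_eq_toFinset_card', toFinset_Iio, Nat.card_Iio, pow_succ]
      calc _ = U.ncard * (Nat.card G.V * (Nat.card A + 1) * (n + 1)) := by ring
        _ ≤ _ := Nat.mul_le_mul_right _ hcard
    · obtain ⟨p⟩ := ‹Nonempty G.V›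
      refine ⟨(p, 0, none, []), ⟨trivial, Nat.succ_pos n, trivial, h0⟩, ?_⟩
      simpa using hcyc p [] (.nil trivial)
    · intro S hS p w q h hn
      -- The walk is cut at the last visit to its own starting vertex, so it cannot avoid that
      -- vertex.
      rcases h.avoid_or_split p with h' | ⟨w₁, w₂, rfl, h1, h2⟩
      · exact absurd h'.source_mem (by simp)
      · have hc := hcyc p w₁ (mono h1)
        rw [List.length_append] at hn
        rcases h2 with rfl | ⟨a, w₃, p', q', rfl, h3⟩
        · exact ⟨(p, w₁.length, none, []), ⟨trivial, Nat.lt_succ_of_le (by omega), trivial, h0⟩,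
            by simp [hc]⟩
        · rw [List.length_cons] at hn
          refine ⟨(p, w₁.length, some a, w₃), ⟨trivial,
            (by omega : w₁.length < n + 1), trivial, hmem _ ?_ p' w₃ q' h3 (by omega)⟩,
            by simp [hc]⟩
          rw [ncard_sdiff_singleton_of_mem h.source_mem]
          omega

end LabeledGraph

/-! ### Free concatenations in sofic shifts; finite type implies sofic. -/

section Sofic

variable {A : Type u}

/-- The concatenation of the words `u` (where `b` is false) and `v` (where `b` is true) of
length `l`. -/
def concat (l : ℕ) (u v : ℕ → A) (b : ℤ → Bool) : ℤ → A :=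
  fun m => (if b (m / l) then v else u) (m % l).toNat

theorem concat_mul_add (l : ℕ) (u v : ℕ → A) (b : ℤ → Bool) (i : ℤ) {j : ℕ} (hj : j < l) :
    concat l u v b (l * i + j) = (if b i then v else u) j := by
  have hl : (l : ℤ) ≠ 0 := by omega
  have h1 : ((l : ℤ) * i + j) / l = i := by
    rw [add_comm, Int.add_mul_ediv_left _ _ hl, Int.ediv_eq_zero_of_lt (by omega) (by omega)]
    simp
  have h2 : ((l : ℤ) * i + j) % l = j := by
    rw [add_comm, Int.add_mul_emod_self_left, Int.emod_eq_of_lt (by omega) (by omega)]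
  rw [concat, h1, h2, Int.toNat_natCast]

variable [TopologicalSpace A]

theorem entropy_nonpos_of_polynomial_bound [Finite A] (X : Subshift A ℤ) {K d : ℕ}
    (h : ∀ n, (blocks X n).ncard ≤ (K * (n + 1)) ^ d) : entropy X ≤ 0 := by
  have hlim : Tendsto (fun n : ℕ => d * (Real.logb 2 (K + 1 : ℕ) * (1 / (n : ℝ)) +
      Real.log ((n + 1 : ℕ) : ℝ) / ((n + 1 : ℕ) : ℝ) * (1 + 1 / (n : ℝ)) / Real.log 2))
      atTop (𝓝 0) := by
    have h2 : Tendsto (fun n : ℕ => 1 / (n : ℝ)) atTop (𝓝 0) := tendsto_one_div_atTop_nhds_zero_nat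
    have h3 : Tendsto (fun n : ℕ => Real.log ((n + 1 : ℕ) : ℝ) / ((n + 1 : ℕ) : ℝ)) atTop (𝓝 0) :=
      (Real.isLittleO_log_id_atTop.tendsto_div_nhds_zero).comp
        (tendsto_natCast_atTop_atTop.comp (tendsto_add_atTop_nat 1))
    simpa using ((h2.const_mul (Real.logb 2 (K + 1 : ℕ))).add
      ((h3.mul (h2.const_add 1)).div_const (Real.log 2))).const_mul (d : ℝ)
  refine le_of_tendsto_of_tendsto (tendsto_entropy X) hlim ?_
  filter_upwards [eventually_gt_atTop 0] with n hn
  have hn' : (0 : ℝ) < n := by exact_mod_cast hn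
  have hK : (0 : ℝ) < (K + 1 : ℕ) := by positivity
  have hn1 : (0 : ℝ) < (n + 1 : ℕ) := by positivity
  have key : Real.logb 2 ((blocks X n).ncard : ℝ) ≤
      Real.logb 2 (((K + 1 : ℕ) * (n + 1 : ℕ) : ℝ) ^ d) := by
    -- Passing to K + 1 keeps the argument of the logarithm positive when K = 0.
    have h1 : (blocks X n).ncard ≤ ((K + 1) * (n + 1)) ^ d :=
      (h n).trans (Nat.pow_le_pow_left (Nat.mul_le_mul_right _ (Nat.le_succ K)) d)
    have h2 : ((blocks X n).ncard : ℝ) ≤ ((K + 1 : ℕ) * (n + 1 : ℕ) : ℝ) ^ d := by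
      exact_mod_cast h1
    rcases Nat.eq_zero_or_pos (blocks X n).ncard with h0 | h0
    · rw [h0, Nat.cast_zero, Real.logb_zero]
      refine Real.logb_nonneg one_lt_two ?_
      exact_mod_cast Nat.one_le_pow _ _ (by positivity)
    · exact Real.logb_le_logb_of_le one_lt_two (by exact_mod_cast h0) h2
  rw [Real.logb_pow, Real.logb_mul hK.ne' hn1.ne'] at key
  rw [div_le_iff₀ hn']
  refine key.trans (le_of_eq ?_)
  have hlog : Real.log 2 ≠ 0 := (Real.log_pos one_lt_two).ne'
  rw [Real.logb, Real.logb]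
  push_cast
  field_simp

/-- A sofic shift of positive entropy contains all concatenations of two different words of the
same length. -/
theorem IsSofic.exists_concat_mem [Finite A] {X : Subshift A ℤ} (hX : 0 < entropy X)
    (h : IsSofic X) : ∃ (l : ℕ) (u v : ℕ → A), (∃ j < l, u j ≠ v j) ∧
      ∀ b, concat l u v b ∈ X.carrier := by
  obtain ⟨G, hG⟩ := h
  obtain ⟨p, w, w', hlen, hw, hw', hne⟩ : ∃ p w w', w.length = w'.length ∧
      G.WalkIn univ p w p ∧ G.WalkIn univ p w' p ∧ w ≠ w' := by
    by_contra! huniq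
    refine hX.not_ge (entropy_nonpos_of_polynomial_bound X
      (K := Nat.card G.V * (Nat.card A + 1)) (d := Nat.card G.V) fun n => ?_)
    rcases isEmpty_or_nonempty G.V with hV | hV
    · have : blocks X n = ∅ := by
        ext w
        rw [mem_blocks_iff, hG]
        simp only [mem_empty_iff_false, iff_false]
        rintro ⟨_, ⟨e, -, -⟩, -⟩
        exact hV.elim (G.source (e 0))
      simp [this]
    · obtain ⟨U, hU, hcard, -, hmem⟩ := G.exists_polynomial_bound huniq n (Nat.card G.V)
      refine (ncard_le_ncard (fun w hw => ?_) hU).trans hcard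
      obtain ⟨x, hx, i, rfl⟩ := (mem_blocks_iff X n w).1 hw
      rw [hG] at hx
      obtain ⟨e, he, rfl⟩ := hx
      exact hmem univ (ncard_univ _).le _ _ _ (LabeledGraph.walkIn_ofFn he n i) (by simp)
  have hl : 0 < w.length := by
    by_contra! h0
    have h0' := h0
    rw [hlen] at h0'
    exact hne (by rw [List.length_eq_zero_iff.1 (by omega : w.length = 0),
      List.length_eq_zero_iff.1 (by omega : w'.length = 0)])
  have : Nonempty G.E := by
    cases hw with
    | nil _ => simp at hl
    | cons e _ _ => exact ⟨e⟩
  obtain ⟨f, g, hg0, hgl, hf⟩ := hw.exists_edges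
  obtain ⟨f', g', hg0', hgl', hf'⟩ := hw'.exists_edges
  refine ⟨w.length, fun j => G.label (f j), fun j => G.label (f' j), ?_, fun b => ?_⟩
  · by_contra! hall
    refine hne (List.ext_getElem hlen fun j h1 h2 => ?_)
    rw [← (hf j h1).2.2, ← (hf' j h2).2.2, hall j h1]
  · rw [hG]
    have hl' : (0 : ℤ) < w.length := by exact_mod_cast hl
    -- The same concatenation is done with edges: every block is a cycle at p, so consecutive blocks
    -- fit together.
    refine ⟨concat w.length f f' b, fun m => ?_, ?_⟩
    · obtain ⟨i, j, hj, rfl⟩ : ∃ (i : ℤ) (j : ℕ), j < w.length ∧ m = w.length * i + j :=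
        ⟨m / w.length, (m % w.length).toNat, by
          have := Int.emod_lt_of_pos m hl'
          omega, by
          have := Int.emod_nonneg m hl'.ne'
          rw [Int.toNat_of_nonneg this, Int.mul_ediv_add_emod]⟩
      have ht : G.target (if b i then f' j else f j) = if b i then g' (j + 1) else g (j + 1) := by
        split_ifs
        · exact (hf' j (hlen ▸ hj)).2.1
        · exact (hf j hj).2.1
      have hs : ∀ i j, j < w.length →
          G.source (if b i then f' j else f j) = if b i then g' j else g j := by
        intro i j hj
        split_ifs
        · exact (hf' j (hlen ▸ hj)).1
        · exact (hf j hj).1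
      rw [concat_mul_add _ _ _ _ _ hj, ite_apply, ht]
      rcases (Nat.succ_le_of_lt hj).eq_or_lt with h1 | h1
      · rw [show (w.length : ℤ) * i + j + 1 = w.length * (i + 1) + (0 : ℕ) by
          push_cast; rw [← h1]; push_cast; ring, concat_mul_add _ _ _ _ _ hl, ite_apply,
          hs _ _ hl, hg0, hg0', ite_self]
        rw [← hlen] at hgl'
        have h1 : j + 1 = w.length := h1
        rw [h1, hgl, hgl', ite_self]
      · rw [show (w.length : ℤ) * i + j + 1 = w.length * i + (j + 1 : ℕ) by push_cast; ring,
          concat_mul_add _ _ _ _ _ h1, ite_apply, hs _ _ h1]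
    · funext m
      simp only [concat]
      split_ifs <;> rfl

/-- A shift of finite type is sofic. -/
theorem IsFiniteType.isSofic [Finite A] {X : Subshift A ℤ} (h : IsFiniteType X) : IsSofic X := by
  obtain ⟨F, hF, hX⟩ := h
  obtain ⟨m, hm⟩ : ∃ m, ∀ w ∈ F, w.length ≤ m := by
    obtain ⟨m, hm⟩ := (hF.image List.length).bddAbove
    exact ⟨m, fun w hw => hm ⟨w, hw, rfl⟩⟩
  -- The higher block graph: edges are the words of length m + 1 of X, from their first m letters to
  -- their last m letters.
  let G : LabeledGraph A :=
    { V := Fin m → A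
      E := {w : Fin (m + 1) → A // ∃ x ∈ X.carrier, ∀ k, w k = x (k : ℕ)}
      finite_V := inferInstance
      finite_E := inferInstance
      source := fun w k => w.1 k.castSucc
      target := fun w k => w.1 k.succ
      label := fun w => w.1 0 }
  refine ⟨G, Subset.antisymm (fun x hx => ?_) ?_⟩
  · refine ⟨fun i => ⟨fun k => x (i + (k : ℕ)), shift i x, X.mapsTo i hx, fun k => rfl⟩,
      fun i => ?_, ?_⟩
    · funext k
      change x (i + ((k.succ : Fin (m + 1)) : ℕ)) = x (i + 1 + ((k.castSucc : Fin (m + 1)) : ℕ))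
      congr 1
      simp
      ring
    · funext i
      change x (i + ((0 : Fin (m + 1)) : ℕ)) = x i
      simp
  · rintro _ ⟨e, he, rfl⟩
    have hstep : ∀ (k : ℕ) (hk : k < m + 1) (i : ℤ), (e i).1 ⟨k, hk⟩ = (e (i + k)).1 0 := by
      intro k
      induction k with
      | zero => intro hk i; simp
      | succ k ih =>
        intro hk i
        have := congrFun (he i) ⟨k, by omega⟩
        rw [show i + ((k + 1 : ℕ) : ℤ) = i + 1 + k by push_cast; ring, ← ih (by omega) (i + 1)]
        exact this
    rw [hX]
    -- A forbidden word has length at most m, so an occurrence at i fits inside the word e i, which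
    -- occurs in a point of X.
    rintro w hw ⟨i, hi⟩
    obtain ⟨x, hx, hex⟩ := (e i).2
    rw [hX] at hx
    refine hx w hw ⟨0, hi.trans ?_⟩
    congr 1
    funext k
    have hk : (k : ℕ) < m + 1 := by
      have := hm w hw
      omega
    rw [zero_add, ← hex ⟨k, hk⟩]
    exact (hstep k hk i).symm

end Sofic

/-! ### The marker section and its visits. -/

section Marker

variable {A : Type u} [TopologicalSpace A] {X : Subshift A ℤ}

/-- The points at which four repetitions of the word `u` of length `l` start. -/
def marked (X : Subshift A ℤ) (l : ℕ) (u : ℕ → A) : Set X.carrier :=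
  {x | ∀ j < 4 * l, x.1 (j : ℤ) = u (j % l)}

/-- The points of `marked X l u`, and those without a visit to that set in the next `N` steps. -/
def markedOrLone (X : Subshift A ℤ) (l : ℕ) (u : ℕ → A) (N : ℕ) : Set X.carrier :=
  marked X l u ∪ ⋂ i ∈ Iio N, (sh ((i : ℕ) : ℤ) ⁻¹' marked X l u)ᶜ

theorem isClopen_markedOrLone [DiscreteTopology A] (l : ℕ) (u : ℕ → A) (N : ℕ) :
    IsClopen (markedOrLone X l u N) := by
  have h : IsClopen (marked X l u) := by
    have : marked X l u = ⋂ j ∈ Iio (4 * l), (fun x : X.carrier => x.1 (j : ℤ)) ⁻¹' {u (j % l)} := by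
      ext x
      simp [marked]
    rw [this]
    exact (finite_Iio _).isClopen_biInter fun j _ => (isClopen_discrete _).preimage
      ((continuous_apply _).comp continuous_subtype_val)
  exact h.union ((finite_Iio _).isClopen_biInter fun i _ =>
    (h.preimage (continuous_sh _)).compl)

/-- The lone points are added for this bound alone; orbits that meet `marked X l u` in every window
of length N gain no visits from them. -/
theorem syndetic_markedOrLone (l : ℕ) (u : ℕ → A) {N : ℕ} (hN : 0 < N) :
    Syndetic (markedOrLone X l u N) N := by
  intro x
  by_cases h : ∃ i < N, sh (i : ℤ) x ∈ marked X l u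
  · obtain ⟨i, hi, hx⟩ := h
    exact ⟨i, hi, .inl hx⟩
  · push Not at h
    exact ⟨0, hN, .inr (by simpa using h)⟩

variable {l : ℕ} {u v : ℕ → A}

/-- An occurrence of four repetitions of `u` covers three equal consecutive blocks. -/
theorem eq_of_sh_concat_mem_marked (hne : ∃ j < l, u j ≠ v j) {b : ℤ → Bool}
    (hb : concat l u v b ∈ X.carrier) {m : ℤ}
    (h : sh m ⟨concat l u v b, hb⟩ ∈ marked X l u) :
    b (m / l + 1) = b (m / l + 2) ∧ b (m / l + 2) = b (m / l + 3) := by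
  obtain ⟨j, hj, hne⟩ := hne
  have hl : (0 : ℤ) < l := by omega
  obtain ⟨r, hr⟩ := Int.eq_ofNat_of_zero_le (Int.emod_nonneg m hl.ne')
  have hrl : r < l := by
    have := Int.emod_lt_of_pos m hl
    omega
  have hm := Int.mul_ediv_add_emod m l
  -- The position j of the three blocks after the one containing m lies at offsets l * t + (l - r +
  -- j) < 4 * l. These are congruent modulo l, so the three letters agree, and u and v differ at j.
  have key : ∀ t < 3, (if b (m / l + (t + 1 : ℕ)) then v else u) j = u ((l - r + j) % l) := by
    intro t ht
    have hlt : l * t ≤ l * 2 := Nat.mul_le_mul_left l (by omega)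
    have h1 := h (l * t + (l - r + j)) (by omega)
    rw [Nat.mul_add_mod] at h1
    rw [← concat_mul_add l u v b _ hj, ← h1]
    change _ = concat l u v b (m + _)
    congr 1
    push_cast [hrl.le]
    linarith
  have inj : ∀ p q : Bool, (if p then v else u) j = (if q then v else u) j → p = q := by
    intro p q hpq
    cases p <;> cases q <;> simp_all
  exact ⟨inj _ _ ((key 0 (by omega)).trans (key 1 (by omega)).symm),
    inj _ _ ((key 1 (by omega)).trans (key 2 (by omega)).symm)⟩

/-! ### Points with few visits and many free bits. -/

/-- The sequence of bits which, in periods of `k + 3` pairs, has three pairs of zeros, followed by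
the pairs consisting of a bit of `s` and its negation. -/
def bits (k : ℕ) (s : ℤ → Bool) (i : ℤ) : Bool :=
  if (i / 2) % (k + 3 : ℕ) < 3 then false else if i % 2 = 0 then s (i / 2) else !s (i / 2)

variable {k : ℕ} {s : ℤ → Bool}

/-- Three consecutive positions contain a full pair, here pair number (i + 2) / 2; outside the
marker a pair consists of two different bits. -/
theorem emod_lt_of_bits_eq {i : ℤ} (h1 : bits k s (i + 1) = bits k s (i + 2))
    (h2 : bits k s (i + 2) = bits k s (i + 3)) : ((i + 2) / 2) % (k + 3 : ℕ) < 3 := by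
  by_contra hcon
  have key : ∀ h : ℤ, ¬ h % (k + 3 : ℕ) < 3 → bits k s (2 * h) ≠ bits k s (2 * h + 1) := by
    intro h hh
    have e1 : 2 * h / 2 = h := by omega
    have e2 : (2 * h + 1) / 2 = h := by omega
    have e3 : 2 * h % 2 = 0 := by omega
    have e4 : (2 * h + 1) % 2 = 1 := by omega
    unfold bits
    rw [e1, e2, e3, e4, if_neg hh, if_neg hh]
    simp
  have := key _ hcon
  rcases Int.even_or_odd' i with ⟨a, rfl | rfl⟩
  · rw [show (2 * a + 2) / 2 = a + 1 by omega, show 2 * (a + 1) = 2 * a + 2 by ring] at this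
    exact this (h2.trans (congrArg _ (by omega)))
  · rw [show (2 * a + 1 + 2) / 2 = a + 1 by omega, show 2 * (a + 1) = 2 * a + 1 + 1 by ring] at this
    exact this (h1.trans (congrArg _ (by omega)))

/-- A period starts with three pairs of zeros, that is six blocks u, of which four are needed. -/
theorem sh_concat_bits_mem_marked (hl : 0 < l) (hb : concat l u v (bits k s) ∈ X.carrier) (z : ℤ) :
    sh ((2 * l * (k + 3) : ℕ) * z) ⟨concat l u v (bits k s), hb⟩ ∈ marked X l u := by
  intro j hj
  obtain ⟨i, r, hi, hr, rfl⟩ : ∃ i r, i < 4 ∧ r < l ∧ j = l * i + r :=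
    ⟨j / l, j % l, by rw [Nat.div_lt_iff_lt_mul hl]; omega, Nat.mod_lt _ hl,
      (Nat.div_add_mod j l).symm⟩
  change concat l u v (bits k s) (_ + _) = _
  have hsplit : ((2 * l * (k + 3) : ℕ) : ℤ) * z + ((l * i + r : ℕ) : ℤ) =
      l * (2 * ((k + 3 : ℕ) * z) + i) + r := by
    push_cast
    ring
  rw [hsplit, concat_mul_add _ _ _ _ _ hr, Nat.mul_add_mod, Nat.mod_eq_of_lt hr]
  have : bits k s (2 * ((k + 3 : ℕ) * z) + i) = false := by
    have h1 : (2 * (((k + 3 : ℕ) : ℤ) * z) + i) / 2 =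
        (i / 2 : ℕ) + ((k + 3 : ℕ) : ℤ) * z := by omega
    have h2 : i / 2 < 3 := by omega
    rw [bits, h1, Int.add_mul_emod_self_left, if_pos]
    rw [Int.emod_eq_of_lt (by omega) (by omega)]
    omega
  rw [this, if_neg Bool.false_ne_true]

/-- The possible visits of a point `concat l u v (bits k s)` in the first `q` periods. -/
def visitSet (l k q : ℕ) : Finset ℤ :=
  (Finset.range (q + 1) ×ˢ Finset.range 3 ×ˢ Finset.range (2 * l)).image fun p =>
    (2 * l : ℕ) * (((k + 3 : ℕ) : ℤ) * p.1 + p.2.1 - 1) + p.2.2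

theorem card_visitSet_le (l k : ℕ) {q : ℕ} (hq : 0 < q) : (visitSet l k q).card ≤ 12 * l * q := by
  refine Finset.card_image_le.trans ?_
  simp only [Finset.card_product, Finset.card_range]
  -- The count 6 * l * (q + 1) is at most 12 * l * q because q ≥ 1.
  nlinarith [Nat.mul_le_mul_left l hq]

theorem mem_visitSet (hne : ∃ j < l, u j ≠ v j) (hb : concat l u v (bits k s) ∈ X.carrier) {q : ℕ}
    {m : ℤ} (h0 : 0 ≤ m) (hm : m < (2 * l * (k + 3) * q : ℕ))
    (h : sh m ⟨concat l u v (bits k s), hb⟩ ∈ markedOrLone X l u (2 * l * (k + 3))) :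
    m ∈ visitSet l k q := by
  have hl : 0 < l := by
    obtain ⟨j, hj, -⟩ := hne
    omega
  have hN : (0 : ℤ) < (2 * l * (k + 3) : ℕ) := by positivity
  -- A lone point is impossible: the next start of a period is marked, and it comes after (−m) mod N
  -- steps, with N the period.
  have hmark : sh m ⟨concat l u v (bits k s), hb⟩ ∈ marked X l u := by
    refine h.resolve_right fun hlone => ?_
    obtain ⟨i, hi⟩ := Int.eq_ofNat_of_zero_le (Int.emod_nonneg (-m) hN.ne')
    have hlt := Int.emod_lt_of_pos (-m) hN
    have hdiv := Int.mul_ediv_add_emod (-m) ((2 * l * (k + 3) : ℕ) : ℤ)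
    have hi' : i ∈ Iio (2 * l * (k + 3)) := by
      rw [mem_Iio]; omega
    refine mem_iInter₂.1 hlone i hi' ?_
    rw [mem_preimage, sh_sh]
    have := sh_concat_bits_mem_marked (s := s) hl hb (-(-m / ((2 * l * (k + 3) : ℕ) : ℤ)))
    convert this using 2
    rw [mul_neg]
    omega
  obtain ⟨h1, h2⟩ := eq_of_sh_concat_mem_marked hne hb hmark
  have h3 := emod_lt_of_bits_eq h1 h2
  have hl2 : (0 : ℤ) < (2 * l : ℕ) := by positivity
  have hK : (0 : ℤ) < (k + 3 : ℕ) := by positivity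
  have h4 : (m / l + 2) / 2 = m / (2 * l : ℕ) + 1 := by
    rw [Int.add_ediv_of_dvd_right (by norm_num), Int.ediv_ediv_of_nonneg (by positivity)]
    push_cast
    rw [mul_comm]
  rw [h4] at h3
  set h := m / (2 * l : ℕ) + 1 with hh
  have h5 : 0 ≤ m / (2 * l : ℕ) := Int.ediv_nonneg h0 hl2.le
  have h6 : m / (2 * l : ℕ) < (k + 3 : ℕ) * q := by
    rw [Int.ediv_lt_iff_lt_mul hl2]
    refine hm.trans_le (le_of_eq ?_)
    push_cast
    ring
  obtain ⟨a, ha⟩ := Int.eq_ofNat_of_zero_le (Int.ediv_nonneg (by omega : 0 ≤ h) hK.le)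
  obtain ⟨e, he⟩ := Int.eq_ofNat_of_zero_le (Int.emod_nonneg h hK.ne')
  obtain ⟨j, hj⟩ := Int.eq_ofNat_of_zero_le (Int.emod_nonneg m hl2.ne')
  -- The zero pair h follows the pair containing m, whence the −1 in `visitSet`. If m lies in the
  -- last pair of the q periods then a = q, whence the range q + 1.
  refine Finset.mem_image.2 ⟨(a, e, j), ?_, ?_⟩
  · simp only [Finset.mem_product, Finset.mem_range]
    refine ⟨?_, by omega, ?_⟩
    · have : h / (k + 3 : ℕ) < q + 1 := by
        rw [Int.ediv_lt_iff_lt_mul hK]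
        have : h ≤ q * (k + 3 : ℕ) := by rw [mul_comm]; omega
        nlinarith
      omega
    · have := Int.emod_lt_of_pos m hl2
      omega
  · have h7 := Int.mul_ediv_add_emod h (k + 3 : ℕ)
    have h8 := Int.mul_ediv_add_emod m (2 * l : ℕ)
    rw [ha, he] at h7
    simp only
    rw [h7, hh, add_sub_cancel_right, ← hj, h8]

/-- The position of the `t`-th free bit in the `a`-th period. -/
def bitPos (q k : ℕ) (p : Fin q × Fin k) : ℤ := (k + 3 : ℕ) * (p.1 : ℕ) + ((p.2 : ℕ) + 3 : ℕ)

theorem bitPos_emod {q k : ℕ} (p : Fin q × Fin k) :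
    bitPos q k p % (k + 3 : ℕ) = ((p.2 : ℕ) + 3 : ℕ) := by
  rw [bitPos, Int.mul_add_emod_self_left, Int.emod_eq_of_lt] <;> omega

theorem bitPos_injective (q k : ℕ) : Function.Injective (bitPos q k) := by
  intro p p' h
  have h1 := bitPos_emod p
  rw [h, bitPos_emod] at h1
  have h2 : (p.2 : ℕ) = p'.2 := by omega
  have h3 : ((k + 3 : ℕ) : ℤ) * (p.1 : ℕ) = (k + 3 : ℕ) * (p'.1 : ℕ) := by
    simp only [bitPos, h2] at h
    omega
  have h4 : ((p.1 : ℕ) : ℤ) = (p'.1 : ℕ) := mul_left_cancel₀ (by positivity) h3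
  exact Prod.ext (Fin.ext (by exact_mod_cast h4)) (Fin.ext h2)

omit [TopologicalSpace A] in
-- The free bit at p is the first bit of the pair `bitPos q k p`; it is visible at a position j
-- where u and v differ.
theorem eq_of_concat_bits_eq (hne : ∃ j < l, u j ≠ v j) {q k : ℕ} {g g' : Fin q × Fin k → Bool}
    (h : ∀ m : ℤ, 0 ≤ m → m < (2 * l * (k + 3) * q : ℕ) →
      concat l u v (bits k (Function.extend (bitPos q k) g fun _ => false)) m =
      concat l u v (bits k (Function.extend (bitPos q k) g' fun _ => false)) m) : g = g' := by
  obtain ⟨j, hj, hne⟩ := hne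
  funext p
  have hbit : ∀ g : Fin q × Fin k → Bool,
      bits k (Function.extend (bitPos q k) g fun _ => false) (2 * bitPos q k p) = g p := by
    intro g
    have e1 : 2 * bitPos q k p / 2 = bitPos q k p := by omega
    have e2 : 2 * bitPos q k p % 2 = 0 := by omega
    rw [bits, e1, e2, bitPos_emod, if_neg (by omega), if_pos rfl,
      (bitPos_injective q k).extend_apply]
  have hpos : 0 ≤ bitPos q k p := by unfold bitPos; positivity
  have hlt : bitPos q k p + 1 ≤ (k + 3 : ℕ) * q := by
    have h1 : ((p.1 : ℕ) : ℤ) + 1 ≤ q := by omega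
    have h2 : ((p.2 : ℕ) : ℤ) + 1 ≤ k := by omega
    have h3 := mul_le_mul_of_nonneg_left h1 (by positivity : (0 : ℤ) ≤ (k + 3 : ℕ))
    unfold bitPos
    push_cast at h3 ⊢
    linarith
  have := h (l * (2 * bitPos q k p) + j) (by positivity) (by
    have h3 := mul_le_mul_of_nonneg_left hlt (by positivity : (0 : ℤ) ≤ 2 * l)
    have h4 : (j : ℤ) < l := by exact_mod_cast hj
    push_cast at h3 ⊢
    linarith)
  rw [concat_mul_add _ _ _ _ _ hj, concat_mul_add _ _ _ _ _ hj, hbit, hbit] at this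
  cases hg : g p <;> cases hg' : g' p <;> simp_all

/-- A subshift which contains all concatenations of two different words of the same length has
flow equivalent subshifts of entropy `L / k` for arbitrarily large `L` and all `k`. -/
theorem exists_large_flowEntropies [Finite A] [DiscreteTopology A] (hne : ∃ j < l, u j ≠ v j)
    (hX : ∀ b, concat l u v b ∈ X.carrier) (R : ℝ) :
    ∃ L : ℝ, R ≤ L ∧ ∀ k : ℕ, 0 < k → L / k ∈ flowEntropies X := by
  have hl : 0 < l := by
    obtain ⟨j, hj, -⟩ := hne
    omega
  have hl' : (0 : ℝ) < 12 * l := by positivity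
  -- With k free bits and at most 12 * l visits per period, on average, the resulting lower bound
  -- for L is k / (12 * l).
  obtain ⟨k, hk⟩ := exists_nat_ge (R * (12 * l))
  have hN := syndetic_markedOrLone (X := X) l u (N := 2 * l * (k + 3)) (by positivity)
  have hC := isClopen_markedOrLone (X := X) l u (2 * l * (k + 3))
  let pt (s : ℤ → Bool) : markedOrLone X l u (2 * l * (k + 3)) :=
    ⟨⟨concat l u v (bits k s), hX _⟩,
      .inl (by simpa using sh_concat_bits_mem_marked (s := s) hl (hX _) 0)⟩
  have : Nonempty (markedOrLone X l u (2 * l * (k + 3))) := ⟨pt fun _ => false⟩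
  obtain ⟨L, hL, hflow⟩ := hN.exists_flowEntropies hC
  refine ⟨L, ?_, hflow⟩
  have hlim := hL.comp (tendsto_id.const_mul_atTop' (by positivity : 0 < 12 * l))
  refine ge_of_tendsto hlim ?_
  filter_upwards [eventually_gt_atTop 0] with q hq
  have hq' : (0 : ℝ) < q := by exact_mod_cast hq
  -- The 2 ^ (q * k) choices of bits in q periods are told apart by names of length 12 * l * q.
  have hcard := hN.card_le_ncard_names hC (S := Fin q × Fin k → Bool) (n := 12 * l * q)
    (Q := (2 * l * (k + 3) * q : ℕ)) (fun g => pt (Function.extend (bitPos q k) g fun _ => false))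
    (fun g => hN.le_visit_of_card_le hC
      (fun m h0 hm h => mem_visitSet hne (hX _) h0 hm h) (card_visitSet_le l k hq))
    (fun g g' h => eq_of_concat_bits_eq hne h)
  have hc : Nat.card (Fin q × Fin k → Bool) = 2 ^ (q * k) := by simp
  rw [hc] at hcard
  have hcard' : (2 : ℝ) ^ (q * k) ≤ ((range (names (hN.returnHomeo hC) hN.returnBlock
      (12 * l * q))).ncard : ℝ) := by exact_mod_cast hcard
  have hlog := Real.logb_le_logb_of_le one_lt_two (by positivity) hcard'
  rw [Real.logb_pow, Real.logb_self_eq_one one_lt_two] at hlog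
  simp only [Function.comp]
  rw [le_div_iff₀ (by simp only [id]; positivity)]
  refine le_trans ?_ hlog
  simp only [id]
  push_cast
  nlinarith

/-- For k = ⌈L / r⌉ one has 0 ≤ r − L / k < r / k ≤ r² / L, which is below ε once L > r² / ε. -/
theorem Ioi_subset_closure_of_concat_mem [Finite A] [DiscreteTopology A]
    (hne : ∃ j < l, u j ≠ v j) (hX : ∀ b, concat l u v b ∈ X.carrier) :
    Ioi (0 : ℝ) ⊆ closure (flowEntropies X) := by
  intro r (hr : 0 < r)
  rw [Metric.mem_closure_iff]
  intro ε hε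
  obtain ⟨L, hL, hflow⟩ := exists_large_flowEntropies hne hX (r ^ 2 / ε + 1)
  have hLpos : 0 < L := lt_of_lt_of_le (by positivity) hL
  have hLr : 0 < L / r := div_pos hLpos hr
  have hk : 0 < ⌈L / r⌉₊ := Nat.ceil_pos.2 hLr
  refine ⟨_, hflow _ hk, ?_⟩
  have hk' : (0 : ℝ) < ⌈L / r⌉₊ := by exact_mod_cast hk
  have h1 : L ≤ r * ⌈L / r⌉₊ := by
    have := Nat.le_ceil (L / r)
    rwa [div_le_iff₀' hr] at this
  have h2 : r * ⌈L / r⌉₊ < L + r := by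
    have := mul_lt_mul_of_pos_left (Nat.ceil_lt_add_one hLr.le) hr
    rwa [mul_add, mul_div_cancel₀ _ hr.ne', mul_one] at this
  have h3 : r ^ 2 < ε * L := by
    have : r ^ 2 / ε < L := by linarith
    rwa [div_lt_iff₀' hε] at this
  rw [Real.dist_eq, abs_of_nonneg (sub_nonneg.2 ((div_le_iff₀ hk').2 h1)), sub_lt_comm,
    lt_div_iff₀ hk']
  have h4 : r * r < ε * (r * ⌈L / r⌉₊) := by nlinarith
  have h5 : r < ε * ⌈L / r⌉₊ := by
    refine lt_of_mul_lt_mul_left ?_ hr.le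
    linarith
  linarith

end Marker

end FlowShift

theorem mainTheorem4 {A : Type u} [Finite A] [TopologicalSpace A] [DiscreteTopology A]
    (X : SymbolicDynamics.FullShift.Subshift A ℤ) (hX : 0 < FlowShift.entropy X) :
    (FlowShift.IsSofic X → Set.Ioi (0 : ℝ) ⊆ closure (FlowShift.flowEntropies X)) ∧
    (FlowShift.IsFiniteType X → Set.Ioi (0 : ℝ) ⊆ closure (FlowShift.flowEntropies X)) := by
  have key (h : FlowShift.IsSofic X) :
      Set.Ioi (0 : ℝ) ⊆ closure (FlowShift.flowEntropies X) := by
    obtain ⟨l, u, v, hne, hmem⟩ := h.exists_concat_mem hX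
    exact FlowShift.Ioi_subset_closure_of_concat_mem hne hmem
  exact ⟨key, fun h => key h.isSofic⟩
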